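/- Let $N\ge 3$, let $B_1\subset\mathbb R^N$ be the open unit ball with surface measure $\sigma$ on $\partial B_1$, and for $\gamma\in\mathbb R$ let \[ \lambda_{1,f,\gamma}=\inf_{\psi\in H^1(B_1)\setminus\{0\}}\frac{\int_{B_1}|\nabla\psi|^2\,dx+\gamma\int_{\partial B_1}\psi^2\,d\sigma}{\int_{B_1}f\psi^2\,dx},\qquad f(x)=|x|^{-2}, \] where $\psi$ is real-valued and its values on $\partial B_1$ are taken in the sense of traces. (i) If $\gamma<\frac{N-2}{2}$, then $\lambda_{1,f,\gamma}=\gamma(N-2-\gamma)$, the infimum is attained by $u_\gamma(x)=|x|^{-\gamma}\in H^1(B_1)$, and every minimizer is a.e. equal to a nonzero constant multiple of $u_\gamma$. (ii) If $\gamma\ge\frac{N-2}{2}$, then $\lambda_{1,f,\gamma}=\left(\frac{N-2}{2}\right)^2$ (the Hardy constant), and the infimum is not attained by any function in $H^1(B_1)\setminus\{0\}$. -/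

import Mathlib

open MeasureTheory Filter Topology
open scoped ContDiff

noncomputable section

namespace RobinHardy

/-- `G` is the distributional gradient of `ψ` on the open set `Ω`: both are locally integrable
on `Ω` and `∫_Ω ψ ∂ᵥφ = - ∫_Ω (G · v) φ` for every `φ ∈ C_c^∞(Ω)` and every direction `v`. -/
def HasWeakGradient {N : ℕ} (Ω : Set (EuclideanSpace ℝ (Fin N)))
    (ψ : EuclideanSpace ℝ (Fin N) → ℝ)
    (G : EuclideanSpace ℝ (Fin N) → EuclideanSpace ℝ (Fin N)) : Prop :=
  LocallyIntegrableOn ψ Ω ∧ LocallyIntegrableOn G Ω ∧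
    ∀ φ : EuclideanSpace ℝ (Fin N) → ℝ, ContDiff ℝ ∞ φ → HasCompactSupport φ → tsupport φ ⊆ Ω →
      ∀ v : EuclideanSpace ℝ (Fin N),
        ∫ x in Ω, ψ x * fderiv ℝ φ x v = - ∫ x in Ω, inner ℝ (G x) v * φ x

/-- The Sobolev space `H¹(Ω)`: square-integrable functions with a square-integrable
weak gradient. Elements that agree a.e. on `Ω` represent the same element. -/
def MemH1 {N : ℕ} (Ω : Set (EuclideanSpace ℝ (Fin N)))
    (ψ : EuclideanSpace ℝ (Fin N) → ℝ) : Prop :=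
  MemLp ψ 2 (volume.restrict Ω) ∧
    ∃ G : EuclideanSpace ℝ (Fin N) → EuclideanSpace ℝ (Fin N),
      MemLp G 2 (volume.restrict Ω) ∧ HasWeakGradient Ω ψ G

open Classical in
/-- The weak gradient of `ψ` on `Ω` (determined a.e. on an open `Ω`); `0` if there is none. -/
def weakGradient {N : ℕ} (Ω : Set (EuclideanSpace ℝ (Fin N)))
    (ψ : EuclideanSpace ℝ (Fin N) → ℝ) : EuclideanSpace ℝ (Fin N) → EuclideanSpace ℝ (Fin N) :=
  if h : ∃ G : EuclideanSpace ℝ (Fin N) → EuclideanSpace ℝ (Fin N), HasWeakGradient Ω ψ G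
  then h.choose else 0

/-- The open unit ball `B₁` of `ℝᴺ`. -/
abbrev unitBall (N : ℕ) : Set (EuclideanSpace ℝ (Fin N)) := Metric.ball 0 1

/-- The unit sphere `∂B₁` of `ℝᴺ`. -/
abbrev unitSphere (N : ℕ) : Set (EuclideanSpace ℝ (Fin N)) := Metric.sphere 0 1

/-- Surface measure `σ` on `∂B₁`, with total mass `N |B₁|`. -/
abbrev surfaceMeasure (N : ℕ) : Measure (unitSphere N) :=
  (volume : Measure (EuclideanSpace ℝ (Fin N))).toSphere

/-- `g ∈ L²(∂B₁)` is the boundary trace of `ψ ∈ H¹(B₁)`: there are functions `vₙ` of class `C¹`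
up to the boundary with `vₙ → ψ` in `H¹(B₁)` and `vₙ|_{∂B₁} → g` in `L²(∂B₁)`. This is the
continuous extension to `H¹(B₁)` of the restriction map `v ↦ v|_{∂B₁}`. -/
def IsTrace {N : ℕ} (ψ : EuclideanSpace ℝ (Fin N) → ℝ) (g : unitSphere N → ℝ) : Prop :=
  MemLp g 2 (surfaceMeasure N) ∧
    ∃ v : ℕ → EuclideanSpace ℝ (Fin N) → ℝ, (∀ n, ContDiff ℝ 1 (v n)) ∧
      Tendsto (fun n => eLpNorm (fun x => v n x - ψ x) 2 (volume.restrict (unitBall N)))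
        atTop (𝓝 0) ∧
      Tendsto (fun n => eLpNorm (fun x => gradient (v n) x - weakGradient (unitBall N) ψ x) 2
        (volume.restrict (unitBall N))) atTop (𝓝 0) ∧
      Tendsto (fun n => eLpNorm (fun y : unitSphere N => v n y - g y) 2 (surfaceMeasure N))
        atTop (𝓝 0)

open Classical in
/-- The boundary trace of `ψ` on `∂B₁`; every `ψ ∈ H¹(B₁)` has one, unique up to
`σ`-null sets. -/
def trace {N : ℕ} (ψ : EuclideanSpace ℝ (Fin N) → ℝ) : unitSphere N → ℝ :=
  if h : ∃ g : unitSphere N → ℝ, IsTrace ψ g then h.choose else 0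

/-- The Robin quotient
`(∫_{B₁} |∇ψ|² dx + γ ∫_{∂B₁} ψ² dσ) / ∫_{B₁} f ψ² dx`. -/
def robinQuotient {N : ℕ} (f : EuclideanSpace ℝ (Fin N) → ℝ) (γ : ℝ)
    (ψ : EuclideanSpace ℝ (Fin N) → ℝ) : ℝ :=
  ((∫ x in unitBall N, ‖weakGradient (unitBall N) ψ x‖ ^ 2)
      + γ * ∫ y, trace ψ y ^ 2 ∂(surfaceMeasure N))
    / ∫ x in unitBall N, f x * ψ x ^ 2

/-- `ψ ∈ H¹(B₁) \ {0}`. -/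
def IsAdmissible {N : ℕ} (ψ : EuclideanSpace ℝ (Fin N) → ℝ) : Prop :=
  MemH1 (unitBall N) ψ ∧ ¬ ψ =ᵐ[volume.restrict (unitBall N)] 0

/-- The weighted first Robin eigenvalue `λ_{1,f,γ}(B₁) = inf_{ψ ∈ H¹(B₁) \ {0}} R_{γ,f}[ψ]`,
an infimum in `[-∞, ∞]`. -/
def robinEigenvalue {N : ℕ} (f : EuclideanSpace ℝ (Fin N) → ℝ) (γ : ℝ) : EReal :=
  ⨅ (ψ : EuclideanSpace ℝ (Fin N) → ℝ) (_ : IsAdmissible ψ), (robinQuotient f γ ψ : EReal)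

/-- The infimum `λ_{1,f,γ}(B₁)` is attained at `ψ`. -/
def IsMinimizer {N : ℕ} (f : EuclideanSpace ℝ (Fin N) → ℝ) (γ : ℝ)
    (ψ : EuclideanSpace ℝ (Fin N) → ℝ) : Prop :=
  IsAdmissible ψ ∧ (robinQuotient f γ ψ : EReal) = robinEigenvalue f γ

/-- The Hardy weight `|x|⁻²`. -/
def hardyWeight (N : ℕ) (x : EuclideanSpace ℝ (Fin N)) : ℝ := (‖x‖ ^ 2)⁻¹

end RobinHardy

end

/-! Write F = ψ x/|x|² (`hardyField`), so that |F|² = ψ²/|x|² and the denominator of the quotient is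
∫|F|². Integrating div(ψ² x/|x|²) over the ball gives the identity (N-2) ∫|F|² + 2 ∫ F·∇ψ = ∫_{∂B₁}
ψ² dσ. Multiplying it by α and completing the square (`robin_form_eq`) yields ∫|∇ψ|² + α ∫_{∂B₁} ψ²
dσ = ∫|∇ψ + αF|² + α(N-2-α) ∫|F|². Hence the quotient is at least α(N-2-α) whenever α ≤ γ, the
surplus (γ-α) ∫_{∂B₁} ψ² dσ being nonnegative (`le_robinQuotient`). Part (i) takes α = γ; part (ii)
takes α = (N-2)/2, where the parabola α(N-2-α) has its maximum.

Equality forces ∇ψ = -αF, which says that |x|^α ψ has zero gradient off the origin. The punctured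
ball is connected, so ψ = c|x|^(-α) (`ae_eq_const_mul_rpow`). For this function ∫|F|² is finite
exactly when α < (N-2)/2 (`memLp_hardyField_rpow_iff`): this makes |x|^(-γ) a minimizer in (i) and
excludes minimizers in (ii). In (ii) the powers |x|^(-β) with β increasing to (N-2)/2 show that the
bound is sharp.

Most of the work is the identity for H¹ functions. For C¹ functions it is the fundamental theorem of
calculus along rays. The same computation bounds the boundary values and v/|x| in L² by the H¹ norm
of v, so all terms pass to the limit along C¹ approximations (`exists_contDiff_approx`), which are
obtained by contracting the ball and mollifying. -/

noncomputable section

namespace RobinHardy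

/-! ### Limits of quadratic integrals under L² convergence -/

section L2

variable {α H : Type*} [MeasurableSpace α] {μ : Measure α} [NormedAddCommGroup H]

theorem eLpNorm_two_sq (f : α → H) (μ : Measure α) :
    eLpNorm f 2 μ ^ 2 = ∫⁻ x, ‖f x‖ₑ ^ 2 ∂μ := by
  have := eLpNorm_nnreal_pow_eq_lintegral (f := f) (μ := μ) (p := 2) two_ne_zero
  simpa using this

theorem integrable_norm_sq {f : α → H} (hf : MemLp f 2 μ) :
    Integrable (fun x => ‖f x‖ ^ 2) μ := hf.integrable_norm_pow two_ne_zero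

theorem eLpNorm_two_sq_eq_ofReal {f : α → H} (hf : MemLp f 2 μ) :
    eLpNorm f 2 μ ^ 2 = ENNReal.ofReal (∫ x, ‖f x‖ ^ 2 ∂μ) := by
  rw [eLpNorm_two_sq, ofReal_integral_eq_lintegral_ofReal (integrable_norm_sq hf)
    (.of_forall fun x => by positivity)]
  refine lintegral_congr fun x => ?_
  rw [ENNReal.ofReal_pow (norm_nonneg _), ofReal_norm]

variable [InnerProductSpace ℝ H]

/-- Integrals of inner products pass to the limit under `L²` convergence of both factors. -/
theorem tendsto_integral_inner {F G : ℕ → α → H} {f g : α → H}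
    (hF : ∀ n, MemLp (F n) 2 μ) (hG : ∀ n, MemLp (G n) 2 μ) (hf : MemLp f 2 μ) (hg : MemLp g 2 μ)
    (hFf : Tendsto (fun n => eLpNorm (fun x => F n x - f x) 2 μ) atTop (𝓝 0))
    (hGg : Tendsto (fun n => eLpNorm (fun x => G n x - g x) 2 μ) atTop (𝓝 0)) :
    Tendsto (fun n => ∫ x, inner ℝ (F n x) (G n x) ∂μ) atTop (𝓝 (∫ x, inner ℝ (f x) (g x) ∂μ)) := by
  have key : ∀ {u v : α → H} (hu : MemLp u 2 μ) (hv : MemLp v 2 μ),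
      ∫ x, inner ℝ (u x) (v x) ∂μ = inner ℝ (hu.toLp u) (hv.toLp v) := by
    intro u v hu hv
    rw [L2.inner_def]
    refine integral_congr_ae ?_
    filter_upwards [hu.coeFn_toLp, hv.coeFn_toLp] with x h1 h2
    rw [h1, h2]
  rw [key hf hg]
  simp_rw [fun n => key (hF n) (hG n)]
  exact ((Lp.tendsto_Lp_iff_tendsto_eLpNorm'' F hF f hf).2 hFf).inner
    ((Lp.tendsto_Lp_iff_tendsto_eLpNorm'' G hG g hg).2 hGg)

theorem tendsto_integral_norm_sq {F : ℕ → α → H} {f : α → H}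
    (hF : ∀ n, MemLp (F n) 2 μ) (hf : MemLp f 2 μ)
    (hFf : Tendsto (fun n => eLpNorm (fun x => F n x - f x) 2 μ) atTop (𝓝 0)) :
    Tendsto (fun n => ∫ x, ‖F n x‖ ^ 2 ∂μ) atTop (𝓝 (∫ x, ‖f x‖ ^ 2 ∂μ)) := by
  simpa only [real_inner_self_eq_norm_sq] using tendsto_integral_inner hF hF hf hf hFf hFf

theorem integrable_inner {f g : α → H} (hf : MemLp f 2 μ) (hg : MemLp g 2 μ) :
    Integrable (fun x => inner ℝ (f x) (g x)) μ := by
  refine (MemLp.integrable_mul hf.norm hg.norm).mono' (hf.1.inner hg.1) ?_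
  exact .of_forall fun x => norm_inner_le_norm _ _

end L2

/-! ### L² bounds for mollification and contraction -/

section Young

variable {E H : Type*} [NormedAddCommGroup E] [InnerProductSpace ℝ E] [FiniteDimensional ℝ E]
  [MeasurableSpace E] [BorelSpace E] [NormedAddCommGroup H] [NormedSpace ℝ H]

open scoped Convolution

/-- Convolution with a probability density is a contraction of `L²`. -/
theorem eLpNorm_convolution_le {K : E → ℝ} (hK : Continuous K)
    (hK1 : ∫⁻ y, ‖K y‖ₑ = 1) {w : E → H} (hw : AEStronglyMeasurable w volume) :
    eLpNorm (K ⋆[ContinuousLinearMap.lsmul ℝ ℝ, volume] w) 2 volume ≤ eLpNorm w 2 volume := by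
  have hmeas : AEMeasurable (fun p : E × E => ‖K p.2‖ₑ * ‖w (p.1 - p.2)‖ₑ ^ 2)
      ((volume : Measure E).prod volume) := by
    have h1 : AEStronglyMeasurable (fun p : E × E => w (p.1 - p.2))
        ((volume : Measure E).prod volume) :=
      hw.comp_quasiMeasurePreserving (quasiMeasurePreserving_sub volume volume)
    exact (hK.measurable.comp measurable_snd).enorm.aemeasurable.mul (h1.enorm.pow_const 2)
  have hpt : ∀ x, ‖(K ⋆[ContinuousLinearMap.lsmul ℝ ℝ, volume] w) x‖ₑ ^ 2
      ≤ ∫⁻ y, ‖K y‖ₑ * ‖w (x - y)‖ₑ ^ 2 := by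
    intro x
    have hwx : AEMeasurable (fun y => ‖w (x - y)‖ₑ) volume :=
      (hw.comp_quasiMeasurePreserving
        (volume.measurePreserving_sub_left x).quasiMeasurePreserving).enorm
    have hKm : Measurable fun y => ‖K y‖ₑ := hK.measurable.enorm
    have h1 : ‖(K ⋆[ContinuousLinearMap.lsmul ℝ ℝ, volume] w) x‖ₑ
        ≤ ∫⁻ y, ‖K y‖ₑ * ‖w (x - y)‖ₑ := by
      refine (enorm_integral_le_lintegral_enorm _).trans (lintegral_mono fun y => ?_)
      simp [enorm_smul]
    -- Cauchy–Schwarz with |K| split as |K|^(1/2) · |K|^(1/2): one factor integrates to 1, the other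
    -- stays with w.
    have h2 := ENNReal.lintegral_mul_le_Lp_mul_Lq volume Real.HolderConjugate.two_two
      (f := fun y => ‖K y‖ₑ ^ (1 / 2 : ℝ)) (g := fun y => ‖K y‖ₑ ^ (1 / 2 : ℝ) * ‖w (x - y)‖ₑ)
      (hKm.pow_const _).aemeasurable ((hKm.pow_const _).aemeasurable.mul hwx)
    have h3 : ∀ y, ((‖K y‖ₑ ^ (1 / 2 : ℝ)) ^ (2 : ℝ)) = ‖K y‖ₑ := fun y => by
      rw [← ENNReal.rpow_mul]; norm_num
    have h4 : ∀ y, ‖K y‖ₑ ^ (1 / 2 : ℝ) * ‖K y‖ₑ ^ (1 / 2 : ℝ) = ‖K y‖ₑ := fun y => by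
      rw [← ENNReal.rpow_add_of_nonneg _ _ (by norm_num) (by norm_num)]; norm_num
    simp only [Pi.mul_apply, ← mul_assoc, h4, ENNReal.mul_rpow_of_nonneg _ _ zero_le_two, h3,
      hK1, ENNReal.one_rpow, one_mul] at h2
    calc _ ≤ _ := pow_le_pow_left' (h1.trans h2) 2
      _ = _ := by
        rw [← ENNReal.rpow_natCast, ← ENNReal.rpow_mul]
        norm_num
  have hsq : eLpNorm (K ⋆[ContinuousLinearMap.lsmul ℝ ℝ, volume] w) 2 volume ^ 2
      ≤ eLpNorm w 2 volume ^ 2 := by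
    rw [eLpNorm_two_sq, eLpNorm_two_sq]
    calc _ ≤ ∫⁻ x, ∫⁻ y, ‖K y‖ₑ * ‖w (x - y)‖ₑ ^ 2 := lintegral_mono hpt
      _ = ∫⁻ y, ∫⁻ x, ‖K y‖ₑ * ‖w (x - y)‖ₑ ^ 2 := lintegral_lintegral_swap hmeas
      _ = ∫⁻ y, ‖K y‖ₑ * ∫⁻ x, ‖w x‖ₑ ^ 2 := by
        refine lintegral_congr fun y => ?_
        rw [lintegral_const_mul' _ _ enorm_ne_top,
          lintegral_sub_right_eq_self (fun x => ‖w x‖ₑ ^ 2) y]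
      _ = _ := by rw [lintegral_mul_const _ hK.measurable.enorm, hK1, one_mul]
  exact (ENNReal.pow_le_pow_left_iff two_ne_zero).1 hsq

theorem aestronglyMeasurable_convolution {K : E → ℝ} (hK : Continuous K)
    {w : E → H} (hw : AEStronglyMeasurable w volume) :
    AEStronglyMeasurable (K ⋆[ContinuousLinearMap.lsmul ℝ ℝ, volume] w) volume :=
  (hK.aestronglyMeasurable.convolution_integrand _ hw).integral_prod_right'

/-- The contraction towards `a` with ratio `t`. -/
def shrink (a : E) (t : ℝ) (x : E) : E := a + t • (x - a)

-- The change of variables costs t^(-dim), at most 2^dim since t ≥ 1/2. Its square root would be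
-- enough for the L² norm; only uniformity in t matters.
omit [NormedSpace ℝ H] in
theorem eLpNorm_comp_shrink {g : E → H} (hg : AEStronglyMeasurable g volume) (a : E) {t : ℝ}
    (ht : 1 / 2 ≤ t) :
    eLpNorm (fun x => g (shrink a t x)) 2 volume
      ≤ (2 : ENNReal) ^ Module.finrank ℝ E * eLpNorm g 2 volume := by
  have ht0 : 0 < t := by linarith
  have hmap : Measure.map (shrink a t) (volume : Measure E)
      = ENNReal.ofReal |(t ^ Module.finrank ℝ E)⁻¹| • (volume : Measure E) := by
    have h : shrink a t = (fun x => (a - t • a) + x) ∘ fun x => t • x := by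
      ext x; simp [shrink, smul_sub]; abel
    rw [h, ← Measure.map_map (by fun_prop) (by fun_prop), Measure.map_addHaar_smul _ ht0.ne',
      Measure.map_smul, map_add_left_eq_self]
  have hcont : Continuous (shrink a t) := by unfold shrink; fun_prop
  have h1 := eLpNorm_map_measure (μ := (volume : Measure E)) (g := g) (p := 2) (f := shrink a t)
    (by rw [hmap]; exact hg.smul_measure _) hcont.aemeasurable
  change eLpNorm (g ∘ shrink a t) 2 volume ≤ _
  rw [← h1, hmap, eLpNorm_smul_measure_of_ne_top (by simp), smul_eq_mul]
  gcongr
  have h2 : ENNReal.ofReal |(t ^ Module.finrank ℝ E)⁻¹| ≤ 2 ^ Module.finrank ℝ E := by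
    rw [abs_of_pos (by positivity), ← inv_pow, ENNReal.ofReal_pow (by positivity)]
    gcongr
    rw [← ENNReal.ofReal_ofNat]
    apply ENNReal.ofReal_le_ofReal
    rw [inv_le_comm₀ ht0 two_pos]
    linarith
  calc _ ≤ ((2 : ENNReal) ^ Module.finrank ℝ E) ^ (1 / (2 : ENNReal)).toReal := by gcongr
    _ ≤ ((2 : ENNReal) ^ Module.finrank ℝ E) ^ (1 : ℝ) := by
      apply ENNReal.rpow_le_rpow_of_exponent_le (one_le_pow₀ one_le_two)
      simp; norm_num
    _ = _ := ENNReal.rpow_one _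

end Young

/-! ### Smoothing by contraction and mollification -/

section Smoothing

open scoped Convolution

variable {E H : Type*} [NormedAddCommGroup E] [InnerProductSpace ℝ E] [FiniteDimensional ℝ E]
  [MeasurableSpace E] [BorelSpace E] [NormedAddCommGroup H] [NormedSpace ℝ H]

/-- The contraction ratio `1 - 1 / (n + 2)`. -/
def ratio (n : ℕ) : ℝ := 1 - 1 / ((n : ℝ) + 2)

theorem half_le_ratio (n : ℕ) : 1 / 2 ≤ ratio n := by
  have : 1 / ((n : ℝ) + 2) ≤ 1 / 2 := by
    apply one_div_le_one_div_of_le two_pos; linarith [n.cast_nonneg (α := ℝ)]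
  unfold ratio; linarith

theorem ratio_lt_one (n : ℕ) : ratio n < 1 := by
  have : 0 < 1 / ((n : ℝ) + 2) := by positivity
  unfold ratio; linarith

theorem tendsto_ratio : Tendsto ratio atTop (𝓝 1) := by
  have h := (tendsto_const_div_atTop_nhds_zero_nat (1 : ℝ)).comp (tendsto_add_atTop_nat 2)
  have h' := (tendsto_const_nhds (x := (1 : ℝ))).sub h
  rw [sub_zero] at h'
  refine h'.congr fun n => ?_
  simp [ratio]

/-- A bump function at the origin, supported well inside the gap that the contraction leaves. -/
def gapBump (r : ℝ) (hr : 0 < r) (n : ℕ) : ContDiffBump (0 : E) where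
  rIn := (1 - ratio n) * r / 4
  rOut := (1 - ratio n) * r / 2
  rIn_pos := by have := ratio_lt_one n; have := mul_pos (sub_pos.2 this) hr; linarith
  rIn_lt_rOut := by have := ratio_lt_one n; have := mul_pos (sub_pos.2 this) hr; linarith

/-- The associated mollifier. -/
def gapKernel (r : ℝ) (hr : 0 < r) (n : ℕ) : E → ℝ := (gapBump (E := E) r hr n).normed volume

/-- Contract towards `a`, then mollify: this only uses values of `w` inside `ball a r` to define
a function smooth up to the boundary of that ball. -/
def smoothing (a : E) (r : ℝ) (hr : 0 < r) (n : ℕ) (w : E → H) (x : E) : H :=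
  (gapKernel r hr n ⋆[ContinuousLinearMap.lsmul ℝ ℝ, volume] w) (shrink a (ratio n) x)

variable {a : E} {r : ℝ} {hr : 0 < r}

theorem continuous_gapKernel (n : ℕ) : Continuous (gapKernel (E := E) r hr n) :=
  (gapBump r hr n).continuous_normed

theorem hasCompactSupport_gapKernel (n : ℕ) : HasCompactSupport (gapKernel (E := E) r hr n) :=
  (gapBump r hr n).hasCompactSupport_normed

theorem lintegral_gapKernel (n : ℕ) : ∫⁻ y, ‖gapKernel (E := E) r hr n y‖ₑ = 1 := by
  have h := ofReal_integral_eq_lintegral_ofReal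
    ((gapBump (E := E) r hr n).integrable_normed (μ := volume))
    (.of_forall (gapBump (E := E) r hr n).nonneg_normed)
  rw [ContDiffBump.integral_normed, ENNReal.ofReal_one] at h
  rw [h]
  refine lintegral_congr fun y => ?_
  exact Real.enorm_eq_ofReal ((gapBump (E := E) r hr n).nonneg_normed y)

omit [FiniteDimensional ℝ E] [MeasurableSpace E] [BorelSpace E] in
theorem continuous_shrink (a : E) (t : ℝ) : Continuous (shrink a t) := by unfold shrink; fun_prop

theorem eLpNorm_smoothing_le (n : ℕ) {w : E → H} (hw : AEStronglyMeasurable w volume) :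
    eLpNorm (smoothing a r hr n w) 2 volume
      ≤ (2 : ENNReal) ^ Module.finrank ℝ E * eLpNorm w 2 volume :=
  (eLpNorm_comp_shrink (aestronglyMeasurable_convolution (continuous_gapKernel n) hw) a
    (half_le_ratio n)).trans (by
      gcongr; exact eLpNorm_convolution_le (continuous_gapKernel n) (lintegral_gapKernel n) hw)

theorem smoothing_add (n : ℕ) {w₁ w₂ : E → H} (h₁ : LocallyIntegrable w₁ volume)
    (h₂ : LocallyIntegrable w₂ volume) :
    smoothing a r hr n (w₁ + w₂) = smoothing a r hr n w₁ + smoothing a r hr n w₂ := by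
  ext x
  exact ConvolutionExistsAt.distrib_add
    ((hasCompactSupport_gapKernel n).convolutionExists_left _ (continuous_gapKernel n) h₁ _)
    ((hasCompactSupport_gapKernel n).convolutionExists_left _ (continuous_gapKernel n) h₂ _)

theorem continuous_smoothing (n : ℕ) {w : E → H} (h : LocallyIntegrable w volume) :
    Continuous (smoothing a r hr n w) :=
  ((hasCompactSupport_gapKernel n).continuous_convolution_left _ (continuous_gapKernel n) h).comp
    (continuous_shrink _ _)

/-- Two displacements occur, each costing at most ε/2: the mollifier averages within distance (1 -
ratio n) r / 2, and the contraction moves a point of the ball by less than (1 - ratio n) r. Both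
fall below the modulus of continuity δ. -/
theorem dist_smoothing_le [CompleteSpace H] {h : E → H} (hh : UniformContinuous h) {ε : ℝ} (hε : 0 < ε) :
    ∀ᶠ n in atTop, ∀ x ∈ Metric.ball a r, ‖smoothing a r hr n h x - h x‖ ≤ ε := by
  obtain ⟨δ, hδ, hδ'⟩ := Metric.uniformContinuous_iff.1 hh (ε / 2) (half_pos hε)
  have h1 : ∀ᶠ n in atTop, (1 - ratio n) * r < δ := by
    have : Tendsto (fun n => (1 - ratio n) * r) atTop (𝓝 ((1 - 1) * r)) :=
      (tendsto_const_nhds.sub tendsto_ratio).mul_const r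
    simp only [sub_self, zero_mul] at this
    exact this.eventually_lt_const hδ
  filter_upwards [h1] with n hn x hx
  have hpos : 0 < (1 - ratio n) * r := mul_pos (sub_pos.2 (ratio_lt_one n)) hr
  have h2 : dist (smoothing a r hr n h x) (h (shrink a (ratio n) x)) ≤ ε / 2 := by
    refine ContDiffBump.dist_normed_convolution_le hh.continuous.aestronglyMeasurable fun y hy => ?_
    refine (hδ' ?_).le
    have : dist y (shrink a (ratio n) x) < (1 - ratio n) * r / 2 := hy
    linarith
  have h3 : dist (h (shrink a (ratio n) x)) (h x) < ε / 2 := by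
    apply hδ'
    have : shrink a (ratio n) x - x = (1 - ratio n) • (a - x) := by
      unfold shrink; module
    rw [dist_eq_norm, this, norm_smul, Real.norm_of_nonneg (sub_pos.2 (ratio_lt_one n)).le,
      ← dist_eq_norm, dist_comm]
    refine lt_of_le_of_lt ?_ hn
    gcongr
    · exact (sub_pos.2 (ratio_lt_one n)).le
    · exact (Metric.mem_ball.1 hx).le
  rw [← dist_eq_norm]
  linarith [dist_triangle (smoothing a r hr n h x) (h (shrink a (ratio n) x)) (h x)]

omit [NormedSpace ℝ H] in
theorem locallyIntegrable_of_memLp_two {w : E → H} (hw : MemLp w 2 (volume : Measure E)) :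
    LocallyIntegrable w volume := hw.locallyIntegrable (by norm_num)

/-- The smoothings converge in `L²(ball a r)`. -/
theorem tendsto_smoothing [CompleteSpace H] {w : E → H} (hw : MemLp w 2 (volume : Measure E)) :
    Tendsto (fun n => eLpNorm (fun x => smoothing a r hr n w x - w x) 2
      (volume.restrict (Metric.ball a r))) atTop (𝓝 0) := by
  rw [ENNReal.tendsto_nhds_zero]
  intro ε hε
  -- With h a continuous compactly supported approximation of w, `C` accounts for the smoothing of w
  -- - h together with w - h itself. `V` is the square root of the volume of the ball and turns the
  -- uniform bound for h into an L² bound.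
  set C : ENNReal := 2 ^ Module.finrank ℝ E + 1 with hC
  have hCt : C ≠ ⊤ := by simp [hC]
  set V : ENNReal := (volume (Metric.ball a r)) ^ (2 : ENNReal).toReal⁻¹ with hV
  have hVt : V ≠ ⊤ := ENNReal.rpow_ne_top_of_nonneg (by simp) measure_ball_lt_top.ne
  by_cases hεt : ε = ⊤
  · simp [hεt]
  obtain ⟨h, hc, hle, hcont, hmem⟩ := hw.exists_hasCompactSupport_eLpNorm_sub_le (by simp)
    (ε := ε / 2 / C) (ENNReal.div_pos (ENNReal.half_pos hε.ne').ne' hCt).ne'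
  have hη : ∃ η : ℝ, 0 < η ∧ V * ENNReal.ofReal η ≤ ε / 2 := by
    refine ⟨(ε / 2 / (V + 1)).toReal, ENNReal.toReal_pos ?_ ?_, ?_⟩
    · exact (ENNReal.div_pos (ENNReal.half_pos hε.ne').ne' (by simp [hVt])).ne'
    · exact (ENNReal.div_lt_top (ENNReal.div_lt_top hεt (by simp)).ne (by simp)).ne
    · rw [ENNReal.ofReal_toReal
        (ENNReal.div_lt_top (ENNReal.div_lt_top hεt (by simp)).ne (by simp)).ne]
      calc _ ≤ (V + 1) * (ε / 2 / (V + 1)) := by gcongr; simp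
        _ ≤ ε / 2 := ENNReal.mul_div_le
  obtain ⟨η, hη0, hη⟩ := hη
  filter_upwards [dist_smoothing_le (hr := hr) (a := a)
    (hc.uniformContinuous_of_continuous hcont) hη0] with n hn
  have hd : MemLp (w - h) 2 (volume : Measure E) := hw.sub hmem
  have hdec : (fun x => smoothing a r hr n w x - w x)
      = (smoothing a r hr n (w - h) - (w - h)) + fun x => smoothing a r hr n h x - h x := by
    have := smoothing_add (a := a) (hr := hr) n (locallyIntegrable_of_memLp_two hd)
      (locallyIntegrable_of_memLp_two hmem)
    rw [sub_add_cancel] at this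
    ext x
    simp [this]
    abel
  have hm1 := (continuous_smoothing (a := a) (hr := hr) n
    (locallyIntegrable_of_memLp_two hd)).aestronglyMeasurable (μ := volume)
  have hm2 := (continuous_smoothing (a := a) (hr := hr) n
    (locallyIntegrable_of_memLp_two hmem)).aestronglyMeasurable (μ := volume)
  rw [hdec]
  refine (eLpNorm_add_le (hm1.sub hd.1).restrict (hm2.sub hmem.1).restrict (by norm_num)).trans ?_
  rw [← ENNReal.add_halves ε]
  refine add_le_add ?_ ?_
  · refine (eLpNorm_mono_measure _ Measure.restrict_le_self).trans ?_
    refine (eLpNorm_sub_le hm1 hd.1 (by norm_num)).trans ?_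
    calc _ ≤ 2 ^ Module.finrank ℝ E * eLpNorm (w - h) 2 volume + eLpNorm (w - h) 2 volume := by
          gcongr; exact eLpNorm_smoothing_le n hd.1
      _ = C * eLpNorm (w - h) 2 volume := by rw [hC]; ring
      _ ≤ C * (ε / 2 / C) := by gcongr
      _ ≤ _ := ENNReal.mul_div_le
  · refine (eLpNorm_le_of_ae_bound (C := η) ?_).trans ?_
    · filter_upwards [ae_restrict_mem measurableSet_ball] with x hx using hn x hx
    · rw [Measure.restrict_apply_univ]
      exact hη

end Smoothing

/-! ### Density of C¹ functions in H¹ of a ball -/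

section Density

open scoped Convolution

variable {N : ℕ} {a : EuclideanSpace ℝ (Fin N)} {r : ℝ} {hr : 0 < r}

/-- The contracted point keeps distance more than (1 - ratio n) r from the sphere, and the kernel
reaches only half as far. The kernel translated to that point is therefore an admissible test
function. -/
theorem closedBall_shrink_subset (hr : 0 < r) (n : ℕ) {x : EuclideanSpace ℝ (Fin N)}
    (hx : x ∈ Metric.ball a r) :
    Metric.closedBall (shrink a (ratio n) x) ((1 - ratio n) * r / 2) ⊆ Metric.ball a r := by
  intro z hz
  have h0 : 0 < ratio n := by linarith [half_le_ratio n]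
  have h1 : dist (shrink a (ratio n) x) a = ratio n * dist x a := by
    rw [dist_eq_norm, dist_eq_norm, shrink, add_sub_cancel_left, norm_smul,
      Real.norm_of_nonneg h0.le]
  have h2 : 0 < (1 - ratio n) * r := mul_pos (sub_pos.2 (ratio_lt_one n)) hr
  have h3 : ratio n * dist x a < ratio n * r := by gcongr; exact hx
  rw [Metric.mem_closedBall] at hz
  rw [Metric.mem_ball]
  linarith [dist_triangle z (shrink a (ratio n) x) a]

theorem contDiff_smoothing (n : ℕ) {w : EuclideanSpace ℝ (Fin N) → ℝ}
    (hw : LocallyIntegrable w volume) : ContDiff ℝ 1 (smoothing a r hr n w) := by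
  refine ContDiff.comp (g := (gapKernel r hr n ⋆[ContinuousLinearMap.lsmul ℝ ℝ, volume] w))
    (f := shrink a (ratio n)) ?_ (by unfold shrink; fun_prop)
  exact (hasCompactSupport_gapKernel n).contDiff_convolution_left (n := 1) _
    (gapBump r hr n).contDiff_normed hw

/-- Inside the ball the smoothing commutes with the weak gradient up to the contraction ratio. -/
theorem gradient_smoothing {ψ : EuclideanSpace ℝ (Fin N) → ℝ}
    {G : EuclideanSpace ℝ (Fin N) → EuclideanSpace ℝ (Fin N)}
    (h : HasWeakGradient (Metric.ball a r) ψ G)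
    (hψ : LocallyIntegrable ((Metric.ball a r).indicator ψ) volume)
    (hG : LocallyIntegrable ((Metric.ball a r).indicator G) volume)
    (n : ℕ) {x : EuclideanSpace ℝ (Fin N)} (hx : x ∈ Metric.ball a r) :
    gradient (smoothing a r hr n ((Metric.ball a r).indicator ψ)) x
      = ratio n • smoothing a r hr n ((Metric.ball a r).indicator G) x := by
  set w := (Metric.ball a r).indicator ψ with hw
  set W := (Metric.ball a r).indicator G with hW
  set K : EuclideanSpace ℝ (Fin N) → ℝ := gapKernel r hr n with hK
  set p := shrink a (ratio n) x with hp
  have hKs : ContDiff ℝ ∞ K := (gapBump r hr n).contDiff_normed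
  have hKc : HasCompactSupport K := hasCompactSupport_gapKernel n
  have hder := hKc.hasFDerivAt_convolution_left (ContinuousLinearMap.lsmul ℝ ℝ)
    (hKs.of_le (by norm_cast)) hψ p
  have hshr : HasFDerivAt (shrink a (ratio n))
      (ratio n • ContinuousLinearMap.id ℝ (EuclideanSpace ℝ (Fin N))) x := by
    unfold shrink
    exact ((((hasFDerivAt_id x).sub_const a).const_smul (ratio n))).const_add a
  have hcomp := hder.comp x hshr
  have htest : ∀ v, ((fderiv ℝ K ⋆[(ContinuousLinearMap.lsmul ℝ ℝ).precompL
      (EuclideanSpace ℝ (Fin N)), volume] w) p) v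
      = inner ℝ ((K ⋆[ContinuousLinearMap.lsmul ℝ ℝ, volume] W) p) v := by
    intro v
    -- The reflected and translated kernel is the test function in the definition of the weak
    -- gradient; reflection supplies the sign that cancels the minus there.
    have hφ := h.2.2 (fun z => K (p - z)) (hKs.comp (by fun_prop))
      (hKc.comp_homeomorph (Homeomorph.subLeft p)) (by
        refine subset_trans ?_ (closedBall_shrink_subset hr n hx)
        refine closure_minimal (fun z hz => ?_) Metric.isClosed_closedBall
        have : p - z ∈ Function.support K := hz
        rw [hK, gapKernel, ContDiffBump.support_normed_eq, mem_ball_zero_iff] at this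
        rw [Metric.mem_closedBall, dist_comm, dist_eq_norm]
        exact this.le) v
    have hfd : ∀ z, fderiv ℝ (fun z => K (p - z)) z v = - fderiv ℝ K (p - z) v := by
      intro z
      have := ((hKs.differentiable (by simp)) (p - z)).hasFDerivAt.comp z
        ((hasFDerivAt_id z).const_sub p)
      rw [HasFDerivAt.fderiv (f := fun z => K (p - z)) this]
      simp
    simp only [hfd] at hφ
    have hex1 := (hKc.fderiv ℝ).convolutionExists_left
      ((ContinuousLinearMap.lsmul ℝ ℝ).precompL (EuclideanSpace ℝ (Fin N)))
      (hKs.continuous_fderiv (by simp)) hψ p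
    have hex2 := hKc.convolutionExists_left (ContinuousLinearMap.lsmul ℝ ℝ) hKs.continuous hG p
    have e1 : ((fderiv ℝ K ⋆[(ContinuousLinearMap.lsmul ℝ ℝ).precompL
        (EuclideanSpace ℝ (Fin N)), volume] w) p) v
        = ∫ z in Metric.ball a r, ψ z * fderiv ℝ K (p - z) v := by
      rw [convolution, ContinuousLinearMap.integral_apply hex1,
        ← integral_sub_left_eq_self _ volume p, ← integral_indicator measurableSet_ball]
      refine integral_congr_ae (.of_forall fun z => ?_)
      by_cases hz : z ∈ Metric.ball a r <;> simp [hw, hz, mul_comm]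
    have e2 : inner ℝ ((K ⋆[ContinuousLinearMap.lsmul ℝ ℝ, volume] W) p) v
        = ∫ z in Metric.ball a r, inner ℝ (G z) v * K (p - z) := by
      rw [convolution, real_inner_comm, ← integral_inner hex2,
        ← integral_sub_left_eq_self _ volume p, ← integral_indicator measurableSet_ball]
      refine integral_congr_ae (.of_forall fun z => ?_)
      by_cases hz : z ∈ Metric.ball a r <;>
        simp [hW, hz, mul_comm, real_inner_smul_right, real_inner_comm v]
    rw [e1, e2, ← neg_inj, ← hφ, ← integral_neg]
    simp
  refine (HasGradientAt.gradient ?_)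
  rw [hasGradientAt_iff_hasFDerivAt]
  refine (hcomp.congr_fderiv ?_ : HasFDerivAt (smoothing a r hr n w) _ x)
  ext v
  simp only [ContinuousLinearMap.comp_apply, smul_apply,
    ContinuousLinearMap.id_apply, map_smul, InnerProductSpace.toDual_apply_apply, smul_eq_mul]
  rw [htest]
  rfl

theorem memLp_indicator_ball {F : Type*} [NormedAddCommGroup F] {w : EuclideanSpace ℝ (Fin N) → F}
    (hw : MemLp w 2 (volume.restrict (Metric.ball a r))) :
    MemLp ((Metric.ball a r).indicator w) 2 volume :=
  (memLp_indicator_iff_restrict measurableSet_ball).2 hw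

/-- Functions that are `C¹` up to the boundary are dense in `H¹` of a ball, and the approximation
keeps a vanishing gradient. -/
theorem exists_contDiff_approx (hr : 0 < r) {ψ : EuclideanSpace ℝ (Fin N) → ℝ}
    {G : EuclideanSpace ℝ (Fin N) → EuclideanSpace ℝ (Fin N)}
    (h : HasWeakGradient (Metric.ball a r) ψ G)
    (hψ : MemLp ψ 2 (volume.restrict (Metric.ball a r)))
    (hG : MemLp G 2 (volume.restrict (Metric.ball a r))) :
    ∃ v : ℕ → EuclideanSpace ℝ (Fin N) → ℝ, (∀ n, ContDiff ℝ 1 (v n)) ∧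
      Tendsto (fun n => eLpNorm (fun x => v n x - ψ x) 2 (volume.restrict (Metric.ball a r)))
        atTop (𝓝 0) ∧
      Tendsto (fun n => eLpNorm (fun x => gradient (v n) x - G x) 2
        (volume.restrict (Metric.ball a r))) atTop (𝓝 0) ∧
      (G = 0 → ∀ n, ∀ x ∈ Metric.ball a r, gradient (v n) x = 0) := by
  have hψ' := memLp_indicator_ball hψ
  have hG' := memLp_indicator_ball hG
  have hgrad := fun n x (hx : x ∈ Metric.ball a r) => gradient_smoothing (hr := hr) h
    (locallyIntegrable_of_memLp_two hψ') (locallyIntegrable_of_memLp_two hG') n hx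
  refine ⟨fun n => smoothing a r hr n ((Metric.ball a r).indicator ψ),
    fun n => contDiff_smoothing n (locallyIntegrable_of_memLp_two hψ'), ?_, ?_, ?_⟩
  · refine (tendsto_smoothing (hr := hr) hψ').congr fun n => eLpNorm_congr_ae ?_
    filter_upwards [ae_restrict_mem measurableSet_ball] with x hx
    rw [Set.indicator_of_mem hx]
  · have h1 := tendsto_smoothing (a := a) (hr := hr) hG'
    have h2 : Tendsto (fun n => ENNReal.ofReal (1 - ratio n)
        * eLpNorm G 2 (volume.restrict (Metric.ball a r))) atTop (𝓝 0) := by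
      have : Tendsto (fun n => ENNReal.ofReal (1 - ratio n)) atTop (𝓝 (ENNReal.ofReal (1 - 1))) :=
        ENNReal.tendsto_ofReal (tendsto_const_nhds.sub tendsto_ratio)
      simpa using ENNReal.Tendsto.mul_const this (Or.inr hG.2.ne)
    have h3 := h1.add h2
    rw [add_zero] at h3
    refine tendsto_of_tendsto_of_tendsto_of_le_of_le tendsto_const_nhds h3 (fun _ => zero_le)
      fun n => ?_
    have hsm := (continuous_smoothing (a := a) (hr := hr) n
      (locallyIntegrable_of_memLp_two hG')).aestronglyMeasurable
      (μ := volume.restrict (Metric.ball a r))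
    -- With t the ratio and S the smoothing operator, tSG - G = t(SG - G) - (1-t)G: the first term
    -- is the mollification error, the second tends to 0 because t tends to 1.
    have hdec : (fun x => gradient (smoothing a r hr n ((Metric.ball a r).indicator ψ)) x - G x)
        =ᵐ[volume.restrict (Metric.ball a r)]
        (ratio n • fun x => smoothing a r hr n ((Metric.ball a r).indicator G) x
          - (Metric.ball a r).indicator G x) - (1 - ratio n) • G := by
      filter_upwards [ae_restrict_mem measurableSet_ball] with x hx
      simp only [hgrad n x hx, Pi.sub_apply, Pi.smul_apply, Set.indicator_of_mem hx]
      module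
    have h0 : 0 ≤ ratio n := by linarith [half_le_ratio n]
    rw [eLpNorm_congr_ae hdec]
    refine (eLpNorm_sub_le ((hsm.sub hG'.1.restrict).const_smul _) (hG.1.const_smul _)
      (by norm_num)).trans ?_
    rw [eLpNorm_const_smul, eLpNorm_const_smul]
    gcongr
    · refine mul_le_of_le_one_left zero_le ?_
      rw [Real.enorm_eq_ofReal h0, ENNReal.ofReal_le_one]
      exact (ratio_lt_one n).le
    · rw [Real.enorm_eq_ofReal (sub_pos.2 (ratio_lt_one n)).le]
  · rintro rfl n x hx
    rw [hgrad n x hx, Set.indicator_zero']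
    simp [smoothing]

end Density

/-! ### Polar coordinates and the radial divergence theorem -/

section Polar

variable {N : ℕ}

/-- Integration over the unit ball in polar coordinates. -/
theorem integral_unitBall_polar [NeZero N] {h : EuclideanSpace ℝ (Fin N) → ℝ}
    (hh : IntegrableOn h (unitBall N)) :
    ∫ x in unitBall N, h x
      = ∫ η, (∫ s in (0 : ℝ)..1, s ^ (N - 1) * h (s • (η : EuclideanSpace ℝ (Fin N))))
          ∂(surfaceMeasure N) := by
  have : Nontrivial (EuclideanSpace ℝ (Fin N)) := by
    refine Module.nontrivial_of_finrank_pos (R := ℝ) ?_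
    simpa using Nat.pos_of_ne_zero (NeZero.ne N)
  let E := EuclideanSpace ℝ (Fin N)
  set g : E → ℝ := (unitBall N).indicator h with hg
  have hgi : Integrable g := (integrable_indicator_iff measurableSet_ball).2 hh
  have hmp := (volume : Measure E).measurePreserving_homeomorphUnitSphereProd
  have hmp' := hmp.symm (homeomorphUnitSphereProd E).toMeasurableEquiv
  have hemb := (homeomorphUnitSphereProd E).symm.measurableEmbedding
  have hgi' : Integrable (fun p : Metric.sphere (0 : E) 1 × Set.Ioi (0 : ℝ) =>
      g ((p.2 : ℝ) • (p.1 : E))) ((volume : Measure E).toSphere.prod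
        (Measure.volumeIoiPow (Module.finrank ℝ E - 1))) := by
    have h1 : Integrable (fun x : ({0}ᶜ : Set E) => g x) (Measure.comap (↑) (volume : Measure E)) :=
      (integrableOn_iff_comap_subtypeVal (measurableSet_singleton _).compl).1 hgi.integrableOn
    exact (hmp'.integrable_comp_emb hemb).2 h1
  rw [← integral_indicator measurableSet_ball, ← hg]
  calc ∫ x, g x = ∫ x : ({0}ᶜ : Set E), g x ∂(Measure.comap (↑) (volume : Measure E)) := by
        rw [integral_subtype_comap (measurableSet_singleton _).compl g, restrict_compl_singleton]
    _ = ∫ p : Metric.sphere (0 : E) 1 × Set.Ioi (0 : ℝ), g ((p.2 : ℝ) • (p.1 : E))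
          ∂((volume : Measure E).toSphere.prod
            (Measure.volumeIoiPow (Module.finrank ℝ E - 1))) :=
        (hmp'.integral_comp hemb (fun x : ({0}ᶜ : Set E) => g x)).symm
    _ = ∫ η, ∫ s : Set.Ioi (0 : ℝ), g ((s : ℝ) • (η : E))
          ∂(Measure.volumeIoiPow (Module.finrank ℝ E - 1)) ∂(volume : Measure E).toSphere :=
        integral_prod _ hgi'
    _ = _ := by
        refine integral_congr_ae (.of_forall fun η => ?_)
        have hη : ‖(η : E)‖ = 1 := by simp
        have hfr : Module.finrank ℝ E - 1 = N - 1 := by simp [E]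
        simp only [hfr, Measure.volumeIoiPow, ENNReal.ofReal]
        rw [integral_withDensity_eq_integral_smul
            ((measurable_subtype_coe.pow_const _).real_toNNReal),
          integral_subtype_comap measurableSet_Ioi
            fun s : ℝ => Real.toNNReal (s ^ (N - 1)) • g (s • (η : E)),
          intervalIntegral.integral_of_le zero_le_one, integral_Ioc_eq_integral_Ioo,
          ← integral_indicator measurableSet_Ioi, ← integral_indicator measurableSet_Ioo]
        refine integral_congr_ae (.of_forall fun s => ?_)
        by_cases hs : 0 < s
        · have hmem : s • (η : E) ∈ unitBall N ↔ s < 1 := by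
            rw [mem_ball_zero_iff, norm_smul, hη, mul_one, Real.norm_of_nonneg hs.le]
          by_cases hs1 : s < 1
          · simp [hs, hs1, hg, hmem, NNReal.smul_def, pow_nonneg hs.le]
          · simp [hs, hs1, hg, hmem]
        · simp [hs]

theorem inner_gradient_eq {v : EuclideanSpace ℝ (Fin N) → ℝ} (hv : ContDiff ℝ 1 v)
    (x y : EuclideanSpace ℝ (Fin N)) : inner ℝ (gradient v x) y = fderiv ℝ v x y := by
  rw [(hasGradientAt_iff_hasFDerivAt.1
    ((hv.differentiable one_ne_zero) x).hasGradientAt).fderiv]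
  simp

theorem continuous_gradient {v : EuclideanSpace ℝ (Fin N) → ℝ} (hv : ContDiff ℝ 1 v) :
    Continuous (gradient v) :=
  (InnerProductSpace.toDual ℝ _).symm.continuous.comp (hv.continuous_fderiv one_ne_zero)

/-- The divergence theorem on the unit ball for the fields `v² |x|^(k-N) x`. -/
theorem integral_radial_divergence [NeZero N] {v : EuclideanSpace ℝ (Fin N) → ℝ}
    (hv : ContDiff ℝ 1 v) {k : ℕ} (hk : k ≠ 0) {W : EuclideanSpace ℝ (Fin N) → ℝ}
    (hW : ∀ x, x ≠ 0 → ‖x‖ ^ (N - 1) * W x = ‖x‖ ^ (k - 1))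
    (hint : IntegrableOn (fun x => (k * v x ^ 2 + 2 * (v x * inner ℝ (gradient v x) x)) * W x)
      (unitBall N)) :
    ∫ x in unitBall N, (k * v x ^ 2 + 2 * (v x * inner ℝ (gradient v x) x)) * W x
      = ∫ y, v y ^ 2 ∂(surfaceMeasure N) := by
  rw [integral_unitBall_polar hint]
  refine integral_congr_ae (.of_forall fun η => ?_)
  have hη : ‖(η : EuclideanSpace ℝ (Fin N))‖ = 1 := by simp
  beta_reduce
  generalize (η : EuclideanSpace ℝ (Fin N)) = e at *
  -- On the ray through e the polar integrand is the derivative of s^k v(se)². The end s = 1 gives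
  -- the boundary value, and the end s = 0 contributes nothing because k ≠ 0.
  have hder : ∀ s : ℝ, HasDerivAt (fun s : ℝ => s ^ k * v (s • e) ^ 2)
      (k * s ^ (k - 1) * v (s • e) ^ 2
        + s ^ k * (2 * v (s • e) * inner ℝ (gradient v (s • e)) e)) s := by
    intro s
    have h1 : HasDerivAt (fun s : ℝ => v (s • e)) (inner ℝ (gradient v (s • e)) e) s := by
      rw [inner_gradient_eq hv]
      have := ((hv.differentiable one_ne_zero) (s • e)).hasFDerivAt.comp_hasDerivAt s
        ((hasDerivAt_id s).smul_const e)
      simpa [Function.comp_def] using this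
    exact ((hasDerivAt_pow k s).mul (h1.pow 2)).congr_deriv (by simp)
  have hcont : Continuous fun s : ℝ => k * s ^ (k - 1) * v (s • e) ^ 2
        + s ^ k * (2 * v (s • e) * inner ℝ (gradient v (s • e)) e) := by
    have hc1 : Continuous fun s : ℝ => v (s • e) := hv.continuous.comp (by fun_prop)
    have hc2 : Continuous fun s : ℝ => inner ℝ (gradient v (s • e)) e :=
      ((continuous_gradient hv).comp (by fun_prop)).inner continuous_const
    fun_prop
  have hftc := intervalIntegral.integral_eq_sub_of_hasDerivAt (fun s _ => hder s)
    (hcont.intervalIntegrable 0 1)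
  simp only [one_pow, one_smul, one_mul, zero_pow hk, zero_mul, sub_zero] at hftc
  rw [← hftc]
  refine intervalIntegral.integral_congr_ae (.of_forall fun s hs => ?_)
  rw [Set.uIoc_of_le zero_le_one] at hs
  have hs0 : 0 < s := hs.1
  have hne : s • e ≠ 0 := by
    rw [← norm_pos_iff, norm_smul, hη, mul_one, Real.norm_of_nonneg hs0.le]; exact hs0
  have hWs := hW _ hne
  rw [norm_smul, hη, mul_one, Real.norm_of_nonneg hs0.le] at hWs
  have hpow : s ^ k = s ^ (k - 1) * s := by rw [← pow_succ, Nat.sub_add_cancel (by omega)]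
  rw [real_inner_smul_right, hpow, mul_left_comm, hWs]
  ring

end Polar

/-! ### The Hardy identity and a priori bounds for C¹ functions -/

section

variable {N : ℕ}

/-- Powers of the norm are integrable on the unit ball exactly above the critical exponent. -/
theorem integrableOn_norm_rpow_iff [NeZero N] (s : ℝ) :
    IntegrableOn (fun x : EuclideanSpace ℝ (Fin N) => ‖x‖ ^ s) (unitBall N) ↔ -(N : ℝ) < s := by
  have : Nontrivial (EuclideanSpace ℝ (Fin N)) := by
    refine Module.nontrivial_of_finrank_pos (R := ℝ) ?_
    simpa using Nat.pos_of_ne_zero (NeZero.ne N)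
  have hN : 1 ≤ N := Nat.pos_of_ne_zero (NeZero.ne N)
  rw [integrableOn_fun_norm_addHaar volume (f := fun y => y ^ s)]
  have h : Set.EqOn (fun y : ℝ => y ^ (Module.finrank ℝ (EuclideanSpace ℝ (Fin N)) - 1) • y ^ s)
      (fun y => y ^ ((N : ℝ) - 1 + s)) (Set.Ioo 0 1) := by
    intro y hy
    simp only [finrank_euclideanSpace, Fintype.card_fin, smul_eq_mul]
    rw [Real.rpow_add hy.1, ← Real.rpow_natCast, Nat.cast_sub hN, Nat.cast_one]
  rw [integrableOn_congr_fun h measurableSet_Ioo,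
    intervalIntegral.integrableOn_Ioo_rpow_iff one_pos]
  constructor <;> intro h <;> linarith

/-- The field `ψ(x) x / |x|²`, whose squared length is `ψ² / |x|²`. -/
def hardyField (ψ : EuclideanSpace ℝ (Fin N) → ℝ) (x : EuclideanSpace ℝ (Fin N)) :
    EuclideanSpace ℝ (Fin N) := (ψ x * (‖x‖ ^ 2)⁻¹) • x

theorem norm_hardyField (ψ : EuclideanSpace ℝ (Fin N) → ℝ) (x : EuclideanSpace ℝ (Fin N)) :
    ‖hardyField ψ x‖ = |ψ x| * ‖x‖⁻¹ := by
  rcases eq_or_ne x 0 with rfl | hx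
  · simp [hardyField]
  · have := norm_pos_iff.2 hx
    rw [hardyField, norm_smul, Real.norm_eq_abs, abs_mul, abs_inv, abs_of_nonneg (sq_nonneg ‖x‖)]
    field_simp

theorem norm_hardyField_sq (ψ : EuclideanSpace ℝ (Fin N) → ℝ) (x : EuclideanSpace ℝ (Fin N)) :
    ‖hardyField ψ x‖ ^ 2 = hardyWeight N x * ψ x ^ 2 := by
  rw [norm_hardyField, mul_pow, sq_abs, hardyWeight, inv_pow, mul_comm]

theorem hardyField_sub (ψ φ : EuclideanSpace ℝ (Fin N) → ℝ) (x : EuclideanSpace ℝ (Fin N)) :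
    hardyField (fun x => ψ x - φ x) x = hardyField ψ x - hardyField φ x := by
  simp only [hardyField, sub_mul, sub_smul]

theorem aestronglyMeasurable_hardyField {ψ : EuclideanSpace ℝ (Fin N) → ℝ}
    {μ : Measure (EuclideanSpace ℝ (Fin N))} (hψ : AEStronglyMeasurable ψ μ) :
    AEStronglyMeasurable (hardyField ψ) μ :=
  (hψ.mul (by fun_prop : Measurable fun x : EuclideanSpace ℝ (Fin N) =>
    (‖x‖ ^ 2)⁻¹).aestronglyMeasurable).smul (by fun_prop)

section Smooth

variable {v : EuclideanSpace ℝ (Fin N) → ℝ}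

instance : IsFiniteMeasure (volume.restrict (unitBall N)) :=
  ⟨by rw [Measure.restrict_apply_univ]; exact measure_ball_lt_top⟩

theorem exists_bound_unitBall {F : Type*} [NormedAddCommGroup F] {w : EuclideanSpace ℝ (Fin N) → F}
    (hw : Continuous w) :
    ∃ C, 0 ≤ C ∧ ∀ x ∈ Metric.closedBall (0 : EuclideanSpace ℝ (Fin N)) 1, ‖w x‖ ≤ C := by
  obtain ⟨C, hC⟩ := (isCompact_closedBall (0 : EuclideanSpace ℝ (Fin N)) 1).exists_bound_of_continuousOn
    hw.continuousOn
  exact ⟨max C 0, le_max_right _ _, fun x hx => (hC x hx).trans (le_max_left _ _)⟩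

theorem memLp_unitBall_of_continuous {F : Type*} [NormedAddCommGroup F]
    {w : EuclideanSpace ℝ (Fin N) → F} (hw : Continuous w) :
    MemLp w 2 (volume.restrict (unitBall N)) := by
  obtain ⟨C, -, hC⟩ := exists_bound_unitBall hw
  refine MemLp.of_bound hw.aestronglyMeasurable C ?_
  filter_upwards [ae_restrict_mem measurableSet_ball] with x hx
    using hC x (Metric.ball_subset_closedBall hx)

theorem memLp_unitSphere_of_continuous (hv : Continuous v) :
    MemLp (fun y : unitSphere N => v y) 2 (surfaceMeasure N) := by
  obtain ⟨C, -, hC⟩ := exists_bound_unitBall hv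
  exact MemLp.of_bound (hv.comp continuous_subtype_val).aestronglyMeasurable C
    (.of_forall fun y => hC y (Metric.sphere_subset_closedBall y.2))

/-- The squared length is at most C²|x|⁻², which is integrable at the origin because N ≥ 3. -/
theorem memLp_hardyField_of_continuous (hN : 3 ≤ N) (hv : Continuous v) :
    MemLp (hardyField v) 2 (volume.restrict (unitBall N)) := by
  have : NeZero N := ⟨by omega⟩
  obtain ⟨C, hC0, hC⟩ := exists_bound_unitBall hv
  have hint : IntegrableOn (fun x : EuclideanSpace ℝ (Fin N) => ‖x‖ ^ (-2 : ℝ)) (unitBall N) := by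
    rw [integrableOn_norm_rpow_iff]
    have : (3 : ℝ) ≤ N := by exact_mod_cast hN
    linarith
  have hm : AEStronglyMeasurable (hardyField v) (volume.restrict (unitBall N)) :=
    aestronglyMeasurable_hardyField hv.aestronglyMeasurable
  rw [memLp_two_iff_integrable_sq_norm hm]
  refine (hint.const_mul (C ^ 2)).mono' (hm.norm.pow 2) ?_
  filter_upwards [ae_restrict_mem measurableSet_ball] with x hx
  rw [Real.norm_of_nonneg (by positivity), norm_hardyField, mul_pow,
    Real.rpow_neg (norm_nonneg _), inv_pow, Real.rpow_two]
  gcongr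
  exact hC x (Metric.ball_subset_closedBall hx)

theorem inner_hardyField (x w : EuclideanSpace ℝ (Fin N)) :
    inner ℝ (hardyField v x) w = v x * inner ℝ w x * (‖x‖ ^ 2)⁻¹ := by
  rw [hardyField, real_inner_smul_left, real_inner_comm]; ring

/-- The divergence theorem for v² x/|x|²; this field has divergence (N-2)v²/|x|² + 2v ∇v·x/|x|². -/
theorem hardy_identity_of_contDiff (hN : 3 ≤ N) (hv : ContDiff ℝ 1 v) :
    ((N : ℝ) - 2) * (∫ x in unitBall N, ‖hardyField v x‖ ^ 2)
      + 2 * ∫ x in unitBall N, inner ℝ (hardyField v x) (gradient v x)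
      = ∫ y, v y ^ 2 ∂(surfaceMeasure N) := by
  have : NeZero N := ⟨by omega⟩
  have hF := memLp_hardyField_of_continuous hN hv.continuous
  have hG := memLp_unitBall_of_continuous (continuous_gradient hv)
  have h1 := (integrable_norm_sq hF).const_mul ((N : ℝ) - 2)
  have h2 := (integrable_inner hF hG).const_mul 2
  have heq : ∀ x, ((N : ℝ) - 2) * ‖hardyField v x‖ ^ 2
      + 2 * inner ℝ (hardyField v x) (gradient v x)
      = ((N - 2 : ℕ) * v x ^ 2 + 2 * (v x * inner ℝ (gradient v x) x)) * (‖x‖ ^ 2)⁻¹ := by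
    intro x
    rw [norm_hardyField_sq, inner_hardyField, hardyWeight, Nat.cast_sub (by omega)]
    push_cast; ring
  rw [← integral_const_mul, ← integral_const_mul, ← integral_add h1 h2]
  have hint := h1.add h2
  simp only [heq] at hint ⊢
  -- N ≥ 3 makes N - 2 nonzero and keeps the subtraction in N - 2 - 1 from truncating.
  refine integral_radial_divergence (k := N - 2) hv (by omega) (fun x hx => ?_) ?_
  · have := norm_pos_iff.2 hx
    have h3 : N - 1 = (N - 2 - 1) + 2 := by omega
    rw [h3, pow_add]
    field_simp
  · exact hint.congr (.of_forall heq)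

/-- The divergence theorem for v² x, followed by |x| ≤ 1 and 2|v||∇v| ≤ v² + |∇v|². This is the
continuity of the trace for the H¹ norm. -/
theorem integral_sphere_sq_le (hN : 3 ≤ N) (hv : ContDiff ℝ 1 v) :
    ∫ y, v y ^ 2 ∂(surfaceMeasure N)
      ≤ (N + 1) * (∫ x in unitBall N, ‖v x‖ ^ 2) + ∫ x in unitBall N, ‖gradient v x‖ ^ 2 := by
  have : NeZero N := ⟨by omega⟩
  have hV := memLp_unitBall_of_continuous hv.continuous
  have hG := memLp_unitBall_of_continuous (continuous_gradient hv)
  have hX := memLp_unitBall_of_continuous (N := N) (w := fun x => v x • x)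
    (hv.continuous.smul continuous_id)
  have hint : IntegrableOn (fun x => ((N : ℕ) * v x ^ 2 + 2 * (v x * inner ℝ (gradient v x) x))
      * (1 : ℝ)) (unitBall N) := by
    refine ((((integrable_norm_sq hV).const_mul (N : ℝ)).add
      ((integrable_inner hX hG).const_mul 2))).congr (.of_forall fun x => ?_)
    simp
  rw [← integral_radial_divergence (W := fun _ => 1) hv (k := N) (by omega) (by simp) hint,
    ← integral_const_mul, ← integral_add ((integrable_norm_sq hV).const_mul _)
      (integrable_norm_sq hG)]
  refine setIntegral_mono_on hint (((integrable_norm_sq hV).const_mul _).add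
      (integrable_norm_sq hG)) measurableSet_ball fun x hx => ?_
  have hx1 : ‖x‖ ≤ 1 := (mem_ball_zero_iff.1 hx).le
  have h1 : |inner ℝ (gradient v x) x| ≤ ‖gradient v x‖ :=
    (abs_real_inner_le_norm _ _).trans (mul_le_of_le_one_right (norm_nonneg _) hx1)
  have h2 : v x * inner ℝ (gradient v x) x ≤ |v x| * ‖gradient v x‖ :=
    (le_abs_self _).trans (by rw [abs_mul]; gcongr)
  have h3 := two_mul_le_add_sq (|v x|) ‖gradient v x‖
  rw [sq_abs] at h3
  rw [Real.norm_eq_abs, sq_abs]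
  linarith

/-- Write A, V, D for the integrals of v²/|x|², v² and |∇v|². The Hardy identity, the boundary
estimate and Young's inequality give (N-2)A ≤ (N+1)V + D + A/2 + 2D. Absorbing A/2 leaves the factor
N - 5/2 ≥ 1/2, whence the constants 2N+2 and 6. -/
theorem integral_hardyField_sq_le (hN : 3 ≤ N) (hv : ContDiff ℝ 1 v) :
    ∫ x in unitBall N, ‖hardyField v x‖ ^ 2
      ≤ (2 * N + 2) * (∫ x in unitBall N, ‖v x‖ ^ 2)
        + 6 * ∫ x in unitBall N, ‖gradient v x‖ ^ 2 := by
  have hF := memLp_hardyField_of_continuous hN hv.continuous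
  have hG := memLp_unitBall_of_continuous (continuous_gradient hv)
  have h1 := hardy_identity_of_contDiff hN hv
  have h2 := integral_sphere_sq_le hN hv
  have h3 : -(∫ x in unitBall N, inner ℝ (hardyField v x) (gradient v x))
      ≤ (1 / 4) * (∫ x in unitBall N, ‖hardyField v x‖ ^ 2)
        + ∫ x in unitBall N, ‖gradient v x‖ ^ 2 := by
    rw [← integral_neg, ← integral_const_mul, ← integral_add
      ((integrable_norm_sq hF).const_mul _) (integrable_norm_sq hG)]
    refine integral_mono (integrable_inner hF hG).neg (((integrable_norm_sq hF).const_mul _).add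
      (integrable_norm_sq hG)) fun x => ?_
    have := neg_le_of_abs_le (abs_real_inner_le_norm (hardyField v x) (gradient v x))
    have h4 := two_mul_le_add_sq ((1 / 2) * ‖hardyField v x‖) ‖gradient v x‖
    simp only
    nlinarith
  have h5 : 0 ≤ ∫ x in unitBall N, ‖hardyField v x‖ ^ 2 := by positivity
  have hN' : (3 : ℝ) ≤ N := by exact_mod_cast hN
  nlinarith

end Smooth

end

/-! ### Passage to H¹: boundary values and the Hardy identity -/

section

section Completeness

variable {α H : Type*} [MeasurableSpace α] {μ : Measure α} [NormedAddCommGroup H] [CompleteSpace H]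

/-- An `L²` Cauchy sequence of functions converges. -/
theorem exists_tendsto_eLpNorm_of_cauchy {f : ℕ → α → H} (hf : ∀ n, MemLp (f n) 2 μ)
    (hc : Tendsto (fun p : ℕ × ℕ => eLpNorm (fun x => f p.1 x - f p.2 x) 2 μ) atTop (𝓝 0)) :
    ∃ g, MemLp g 2 μ ∧ Tendsto (fun n => eLpNorm (fun x => f n x - g x) 2 μ) atTop (𝓝 0) := by
  have hcau : CauchySeq fun n => (hf n).toLp (f n) := by
    rw [Lp.cauchySeq_Lp_iff_cauchySeq_eLpNorm]
    refine hc.congr fun p => eLpNorm_congr_ae ?_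
    filter_upwards [(hf p.1).coeFn_toLp, (hf p.2).coeFn_toLp] with x h1 h2
    rw [Pi.sub_apply, h1, h2]
  obtain ⟨g, hg⟩ := cauchySeq_tendsto_of_complete hcau
  refine ⟨g, Lp.memLp g, ?_⟩
  rw [Lp.tendsto_Lp_iff_tendsto_eLpNorm'] at hg
  refine hg.congr fun n => eLpNorm_congr_ae ?_
  filter_upwards [(hf n).coeFn_toLp] with x h1
  rw [Pi.sub_apply, h1]

omit [CompleteSpace H] in
theorem tendsto_eLpNorm_sub_pair {f : ℕ → α → H} {g : α → H} (hf : ∀ n, MemLp (f n) 2 μ)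
    (hg : MemLp g 2 μ) (h : Tendsto (fun n => eLpNorm (fun x => f n x - g x) 2 μ) atTop (𝓝 0)) :
    Tendsto (fun p : ℕ × ℕ => eLpNorm (fun x => f p.1 x - f p.2 x) 2 μ) atTop (𝓝 0) := by
  have h1 : Tendsto (fun p : ℕ × ℕ => eLpNorm (fun x => f p.1 x - g x) 2 μ
      + eLpNorm (fun x => f p.2 x - g x) 2 μ) atTop (𝓝 0) := by
    rw [← prod_atTop_atTop_eq, ← add_zero (0 : ENNReal)]
    exact (h.comp tendsto_fst).add (h.comp tendsto_snd)
  refine tendsto_of_tendsto_of_tendsto_of_le_of_le tendsto_const_nhds h1 (fun _ => zero_le)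
    fun p => ?_
  have : (fun x => f p.1 x - f p.2 x)
      = (fun x => f p.1 x - g x) - fun x => f p.2 x - g x := by ext x; simp
  simp only [this]
  exact eLpNorm_sub_le ((hf p.1).sub hg).1 ((hf p.2).sub hg).1 (by norm_num)

end Completeness

variable {N : ℕ} {ψ : EuclideanSpace ℝ (Fin N) → ℝ}
  {G : EuclideanSpace ℝ (Fin N) → EuclideanSpace ℝ (Fin N)}

theorem gradient_sub {v w : EuclideanSpace ℝ (Fin N) → ℝ} (hv : ContDiff ℝ 1 v)
    (hw : ContDiff ℝ 1 w) (x : EuclideanSpace ℝ (Fin N)) :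
    gradient (fun x => v x - w x) x = gradient v x - gradient w x := by
  simp only [gradient]
  rw [fderiv_fun_sub (hv.differentiable one_ne_zero x) (hw.differentiable one_ne_zero x), map_sub]

/-- A linear operator on `C¹` functions that is bounded for the `H¹` norm maps sequences which
converge in `H¹` to convergent sequences in `L²`. -/
theorem exists_tendsto_of_bounded {α H : Type*} [MeasurableSpace α] {μ : Measure α}
    [NormedAddCommGroup H] [CompleteSpace H] {T : (EuclideanSpace ℝ (Fin N) → ℝ) → α → H}
    (hTm : ∀ v, ContDiff ℝ 1 v → MemLp (T v) 2 μ)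
    (hTs : ∀ v w, T (fun x => v x - w x) = fun x => T v x - T w x) {C : ℝ} (hC : 0 ≤ C)
    (hTb : ∀ v, ContDiff ℝ 1 v → ∫ x, ‖T v x‖ ^ 2 ∂μ
      ≤ C * ((∫ x in unitBall N, ‖v x‖ ^ 2) + ∫ x in unitBall N, ‖gradient v x‖ ^ 2))
    {v : ℕ → EuclideanSpace ℝ (Fin N) → ℝ} (hv : ∀ n, ContDiff ℝ 1 (v n))
    (hψ : MemLp ψ 2 (volume.restrict (unitBall N))) (hG : MemLp G 2 (volume.restrict (unitBall N)))
    (h1 : Tendsto (fun n => eLpNorm (fun x => v n x - ψ x) 2 (volume.restrict (unitBall N)))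
        atTop (𝓝 0))
    (h2 : Tendsto (fun n => eLpNorm (fun x => gradient (v n) x - G x) 2
        (volume.restrict (unitBall N))) atTop (𝓝 0)) :
    ∃ g, MemLp g 2 μ ∧ Tendsto (fun n => eLpNorm (fun x => T (v n) x - g x) 2 μ) atTop (𝓝 0) := by
  refine exists_tendsto_eLpNorm_of_cauchy (fun n => hTm _ (hv n)) ?_
  have c1 := tendsto_eLpNorm_sub_pair (fun n => memLp_unitBall_of_continuous (hv n).continuous)
    hψ h1
  have c2 := tendsto_eLpNorm_sub_pair
    (fun n => memLp_unitBall_of_continuous (continuous_gradient (hv n))) hG h2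
  -- The bound applied to differences makes the image sequence Cauchy in L².
  have hle : ∀ p : ℕ × ℕ, eLpNorm (fun x => T (v p.1) x - T (v p.2) x) 2 μ ^ 2
      ≤ ENNReal.ofReal C * (eLpNorm (fun x => v p.1 x - v p.2 x) 2
          (volume.restrict (unitBall N)) ^ 2
        + eLpNorm (fun x => gradient (v p.1) x - gradient (v p.2) x) 2
          (volume.restrict (unitBall N)) ^ 2) := by
    intro p
    have hd : ContDiff ℝ 1 fun x => v p.1 x - v p.2 x := (hv p.1).sub (hv p.2)
    have hb := hTb _ hd
    rw [← hTs, eLpNorm_two_sq_eq_ofReal (hTm _ hd)]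
    simp only [← gradient_sub (hv p.1) (hv p.2)]
    rw [eLpNorm_two_sq_eq_ofReal (memLp_unitBall_of_continuous hd.continuous),
      eLpNorm_two_sq_eq_ofReal (memLp_unitBall_of_continuous (continuous_gradient hd)),
      ← ENNReal.ofReal_add (by positivity) (by positivity), ← ENNReal.ofReal_mul hC]
    exact ENNReal.ofReal_le_ofReal hb
  have hlim : Tendsto (fun p : ℕ × ℕ => ENNReal.ofReal C * (eLpNorm (fun x => v p.1 x - v p.2 x) 2
          (volume.restrict (unitBall N)) ^ 2
        + eLpNorm (fun x => gradient (v p.1) x - gradient (v p.2) x) 2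
          (volume.restrict (unitBall N)) ^ 2)) atTop (𝓝 0) := by
    have := ENNReal.Tendsto.const_mul (a := ENNReal.ofReal C)
      ((ENNReal.Tendsto.pow (n := 2) c1).add (ENNReal.Tendsto.pow (n := 2) c2))
      (Or.inr ENNReal.ofReal_ne_top)
    simpa using this
  have hsq := tendsto_of_tendsto_of_tendsto_of_le_of_le tendsto_const_nhds hlim
    (fun _ => zero_le) hle
  have := (ENNReal.continuous_rpow_const (y := 1 / 2)).tendsto 0 |>.comp hsq
  simp only [Function.comp_def, one_div, inv_pos, Nat.ofNat_pos, ENNReal.zero_rpow_of_pos] at this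
  refine this.congr fun p => ?_
  rw [← ENNReal.rpow_natCast, ← ENNReal.rpow_mul]
  norm_num

/-- Sequences of `C¹` functions which converge in `H¹` have convergent boundary values. -/
theorem exists_tendsto_boundary (hN : 3 ≤ N)
    {v : ℕ → EuclideanSpace ℝ (Fin N) → ℝ} (hv : ∀ n, ContDiff ℝ 1 (v n))
    (hψ : MemLp ψ 2 (volume.restrict (unitBall N))) (hG : MemLp G 2 (volume.restrict (unitBall N)))
    (h1 : Tendsto (fun n => eLpNorm (fun x => v n x - ψ x) 2 (volume.restrict (unitBall N)))
        atTop (𝓝 0))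
    (h2 : Tendsto (fun n => eLpNorm (fun x => gradient (v n) x - G x) 2
        (volume.restrict (unitBall N))) atTop (𝓝 0)) :
    ∃ g : unitSphere N → ℝ, MemLp g 2 (surfaceMeasure N) ∧ Tendsto (fun n =>
      eLpNorm (fun y : unitSphere N => v n y - g y) 2 (surfaceMeasure N)) atTop (𝓝 0) := by
  have hb : ∀ v : EuclideanSpace ℝ (Fin N) → ℝ, ContDiff ℝ 1 v →
      ∫ y : unitSphere N, ‖v y‖ ^ 2 ∂(surfaceMeasure N) ≤ ((N : ℝ) + 1)
        * ((∫ x in unitBall N, ‖v x‖ ^ 2) + ∫ x in unitBall N, ‖gradient v x‖ ^ 2) := by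
    intro v hv
    have := integral_sphere_sq_le hN hv
    have h0 : 0 ≤ ∫ x in unitBall N, ‖gradient v x‖ ^ 2 := by positivity
    have h0' : 0 ≤ (N : ℝ) := by positivity
    simp only [Real.norm_eq_abs, sq_abs] at this ⊢
    nlinarith
  exact exists_tendsto_of_bounded (α := unitSphere N) (H := ℝ) (μ := surfaceMeasure N)
    (T := fun (v : EuclideanSpace ℝ (Fin N) → ℝ) (y : unitSphere N) => v y)
    (fun v hv => memLp_unitSphere_of_continuous hv.continuous)
    (fun _ _ => rfl) (by positivity) hb hv hψ hG h1 h2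

theorem ae_ne_zero_unitBall [NeZero N] :
    ∀ᵐ x : EuclideanSpace ℝ (Fin N) ∂(volume.restrict (unitBall N)), x ≠ 0 := by
  have : Nontrivial (EuclideanSpace ℝ (Fin N)) :=
    Module.nontrivial_of_finrank_pos (R := ℝ) (by simpa using Nat.pos_of_ne_zero (NeZero.ne N))
  exact ae_restrict_of_ae (Measure.ae_ne volume 0)

/-- Hardy's inequality, in the form that `v ↦ v / |x|` is continuous on `H¹`. -/
theorem tendsto_hardyField (hN : 3 ≤ N)
    {v : ℕ → EuclideanSpace ℝ (Fin N) → ℝ} (hv : ∀ n, ContDiff ℝ 1 (v n))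
    (hψ : MemLp ψ 2 (volume.restrict (unitBall N))) (hG : MemLp G 2 (volume.restrict (unitBall N)))
    (h1 : Tendsto (fun n => eLpNorm (fun x => v n x - ψ x) 2 (volume.restrict (unitBall N)))
        atTop (𝓝 0))
    (h2 : Tendsto (fun n => eLpNorm (fun x => gradient (v n) x - G x) 2
        (volume.restrict (unitBall N))) atTop (𝓝 0)) :
    MemLp (hardyField ψ) 2 (volume.restrict (unitBall N)) ∧
      Tendsto (fun n => eLpNorm (fun x => hardyField (v n) x - hardyField ψ x) 2
        (volume.restrict (unitBall N))) atTop (𝓝 0) := by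
  have : NeZero N := ⟨by omega⟩
  set μ : Measure (EuclideanSpace ℝ (Fin N)) := volume.restrict (unitBall N) with hμ
  have hne : ∀ᵐ x ∂μ, x ≠ 0 := ae_ne_zero_unitBall
  have hnorm : ∀ (w : EuclideanSpace ℝ (Fin N) → ℝ) x, ‖w x * ‖x‖⁻¹‖ = ‖hardyField w x‖ := by
    intro w x
    rw [norm_hardyField, norm_mul, Real.norm_eq_abs, norm_inv, norm_norm]
  have hmeas : ∀ {w : EuclideanSpace ℝ (Fin N) → ℝ}, AEStronglyMeasurable w μ →
      AEStronglyMeasurable (fun x => w x * ‖x‖⁻¹) μ := fun hw =>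
    hw.mul (by fun_prop : Measurable fun x : EuclideanSpace ℝ (Fin N) =>
      ‖x‖⁻¹).aestronglyMeasurable
  -- The scalar v/|x| has the same length as the Hardy field and makes the limit easier to identify.
  -- The constant 2N + 6 dominates both 2N + 2 and 6.
  obtain ⟨g, hg, hlim⟩ := exists_tendsto_of_bounded (T := fun v x => v x * ‖x‖⁻¹) (C := 2 * N + 6)
    (μ := μ) (fun v hv => (memLp_hardyField_of_continuous hN hv.continuous).of_le
      (hmeas hv.continuous.aestronglyMeasurable) (.of_forall fun x => (hnorm v x).le))
    (fun v w => by ext x; ring) (by positivity)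
    (fun v hv => by
      have := integral_hardyField_sq_le hN hv
      have h0 : 0 ≤ ∫ x in unitBall N, ‖gradient v x‖ ^ 2 := by positivity
      have h0' : 0 ≤ ∫ x in unitBall N, ‖v x‖ ^ 2 := by positivity
      have h0'' : 0 ≤ (N : ℝ) := by positivity
      simp only [hnorm]
      nlinarith) hv hψ hG h1 h2
  -- Multiplication by |x| ≤ 1 does not increase L² norms on the ball, so the approximations
  -- converge to |x| g as well as to ψ.
  have hgψ : g =ᵐ[μ] fun x => ψ x * ‖x‖⁻¹ := by
    have hgm : AEStronglyMeasurable (fun x => ‖x‖ * g x) μ :=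
      (by fun_prop : Continuous fun x : EuclideanSpace ℝ (Fin N) =>
        ‖x‖).aestronglyMeasurable.mul hg.1
    have hz : eLpNorm (fun x => ψ x - ‖x‖ * g x) 2 μ = 0 := by
      have hs := hlim.add h1
      rw [add_zero] at hs
      refine le_antisymm (ge_of_tendsto' hs fun n => ?_) zero_le
      have hm1 : AEStronglyMeasurable (fun x => v n x - ‖x‖ * g x) μ :=
        (hv n).continuous.aestronglyMeasurable.sub hgm
      have hm2 : AEStronglyMeasurable (fun x => v n x - ψ x) μ :=
        (hv n).continuous.aestronglyMeasurable.sub hψ.1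
      have hdec : (fun x => ψ x - ‖x‖ * g x)
          = (fun x => v n x - ‖x‖ * g x) - fun x => v n x - ψ x := by ext x; simp
      rw [hdec]
      refine (eLpNorm_sub_le hm1 hm2 (by norm_num)).trans ?_
      gcongr
      refine eLpNorm_mono_ae ?_
      filter_upwards [hne, ae_restrict_mem measurableSet_ball] with x hx0 hx
      have hx1 : ‖x‖ ≤ 1 := (mem_ball_zero_iff.1 hx).le
      have hx2 : 0 < ‖x‖ := norm_pos_iff.2 hx0
      have : v n x - ‖x‖ * g x = ‖x‖ * (v n x * ‖x‖⁻¹ - g x) := by field_simp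
      rw [this, norm_mul, norm_norm]
      exact mul_le_of_le_one_left (norm_nonneg _) hx1
    replace hz := (eLpNorm_eq_zero_iff (hψ.1.sub hgm) two_ne_zero).1 hz
    filter_upwards [hz, hne] with x hx hx0
    have hx2 : 0 < ‖x‖ := norm_pos_iff.2 hx0
    have hx' : ψ x = ‖x‖ * g x := sub_eq_zero.1 hx
    rw [hx']
    field_simp
  have hF : MemLp (hardyField ψ) 2 μ := by
    refine (hg.ae_eq hgψ).of_le (aestronglyMeasurable_hardyField hψ.1) ?_
    exact .of_forall fun x => (hnorm ψ x).ge
  refine ⟨hF, hlim.congr fun n => ?_⟩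
  refine eLpNorm_congr_norm_ae ?_
  filter_upwards [hgψ] with x hx
  rw [← hardyField_sub, ← hnorm, hx, ← sub_mul]

/-- The integrated form of `div (ψ² x / |x|²)` for an `H¹` function. -/
theorem hardy_identity (hN : 3 ≤ N)
    {v : ℕ → EuclideanSpace ℝ (Fin N) → ℝ} (hv : ∀ n, ContDiff ℝ 1 (v n))
    (hψ : MemLp ψ 2 (volume.restrict (unitBall N))) (hG : MemLp G 2 (volume.restrict (unitBall N)))
    (h1 : Tendsto (fun n => eLpNorm (fun x => v n x - ψ x) 2 (volume.restrict (unitBall N)))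
        atTop (𝓝 0))
    (h2 : Tendsto (fun n => eLpNorm (fun x => gradient (v n) x - G x) 2
        (volume.restrict (unitBall N))) atTop (𝓝 0))
    {g : unitSphere N → ℝ} (hg : MemLp g 2 (surfaceMeasure N))
    (h3 : Tendsto (fun n => eLpNorm (fun y : unitSphere N => v n y - g y) 2 (surfaceMeasure N))
        atTop (𝓝 0)) :
    ((N : ℝ) - 2) * (∫ x in unitBall N, ‖hardyField ψ x‖ ^ 2)
      + 2 * ∫ x in unitBall N, inner ℝ (hardyField ψ x) (G x)
      = ∫ y, g y ^ 2 ∂(surfaceMeasure N) := by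
  obtain ⟨hF, hlim⟩ := tendsto_hardyField hN hv hψ hG h1 h2
  have hFn := fun n => memLp_hardyField_of_continuous hN (hv n).continuous
  have hGn := fun n => memLp_unitBall_of_continuous (continuous_gradient (hv n))
  have l1 := (tendsto_integral_norm_sq hFn hF hlim).const_mul ((N : ℝ) - 2)
  have l2 := (tendsto_integral_inner hFn hGn hF hG hlim h2).const_mul 2
  have l3 := tendsto_integral_norm_sq
    (fun n => memLp_unitSphere_of_continuous (hv n).continuous) hg h3
  simp only [Real.norm_eq_abs, sq_abs] at l3
  refine tendsto_nhds_unique (l1.add l2) (l3.congr fun n => ?_)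
  exact (hardy_identity_of_contDiff hN (hv n)).symm

/-! ### Uniqueness of the weak gradient -/

section WeakGradient

variable {Ω : Set (EuclideanSpace ℝ (Fin N))}

theorem integrableOn_mul_of_test {H : Type*} [NormedAddCommGroup H] [NormedSpace ℝ H]
    {f : EuclideanSpace ℝ (Fin N) → H}
    (hf : LocallyIntegrableOn f Ω) {φ : EuclideanSpace ℝ (Fin N) → ℝ} (hφ : Continuous φ)
    (hc : HasCompactSupport φ) (hs : tsupport φ ⊆ Ω) : Integrable (fun x => φ x • f x) := by
  rw [← integrableOn_iff_integrable_of_support_subset (s := tsupport φ)]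
  · exact (hf.integrableOn_compact_subset hs hc).continuousOn_smul hφ.continuousOn hc
  · exact (Function.support_smul_subset_left _ _).trans (subset_tsupport φ)

theorem setIntegral_eq_of_test {H : Type*} [NormedAddCommGroup H] [NormedSpace ℝ H]
    (f : EuclideanSpace ℝ (Fin N) → H) {φ : EuclideanSpace ℝ (Fin N) → ℝ}
    (hs : tsupport φ ⊆ Ω) : ∫ x in Ω, φ x • f x = ∫ x, φ x • f x := by
  refine setIntegral_eq_integral_of_forall_compl_eq_zero fun x hx => ?_
  rw [image_eq_zero_of_notMem_tsupport fun h => hx (hs h), zero_smul]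

/-- The weak gradient is unique up to null sets. -/
theorem HasWeakGradient.ae_eq (hΩ : IsOpen Ω)
    {G₁ G₂ : EuclideanSpace ℝ (Fin N) → EuclideanSpace ℝ (Fin N)}
    (h₁ : HasWeakGradient Ω ψ G₁) (h₂ : HasWeakGradient Ω ψ G₂) :
    G₁ =ᵐ[volume.restrict Ω] G₂ := by
  have key : ∀ᵐ x ∂volume, x ∈ Ω → (G₁ - G₂) x = 0 := by
    refine hΩ.ae_eq_zero_of_integral_contDiff_smul_eq_zero (h₁.2.1.sub h₂.2.1)
      fun φ hφ hc hs => ?_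
    have i1 := integrableOn_mul_of_test h₁.2.1 hφ.continuous hc hs
    have i2 := integrableOn_mul_of_test h₂.2.1 hφ.continuous hc hs
    -- Tested in each direction v, both vector integrals equal -∫ ψ ∂ᵥφ, which does not involve the
    -- gradient.
    refine ext_inner_left ℝ fun v => ?_
    have e : ∀ {G : EuclideanSpace ℝ (Fin N) → EuclideanSpace ℝ (Fin N)},
        HasWeakGradient Ω ψ G → Integrable (fun x => φ x • G x) →
        inner ℝ v (∫ x, φ x • G x) = - ∫ x in Ω, ψ x * fderiv ℝ φ x v := by
      intro G h hi
      rw [h.2.2 φ hφ hc hs v, neg_neg, ← integral_inner hi]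
      simp only [real_inner_smul_right]
      refine Eq.trans (setIntegral_eq_of_test (fun x => inner ℝ v (G x)) hs).symm ?_
      refine integral_congr_ae (.of_forall fun x => ?_)
      simp [real_inner_comm v, mul_comm]
    simp only [Pi.sub_apply, smul_sub]
    rw [integral_sub i1 i2, inner_sub_right, e h₁ i1, e h₂ i2, sub_self, inner_zero_right]
  rw [Filter.EventuallyEq, ae_restrict_iff' hΩ.measurableSet]
  filter_upwards [key] with x hx hxΩ
  exact sub_eq_zero.1 (hx hxΩ)

theorem weakGradient_ae_eq (hΩ : IsOpen Ω) (h : HasWeakGradient Ω ψ G) :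
    weakGradient Ω ψ =ᵐ[volume.restrict Ω] G := by
  have hex : ∃ G, HasWeakGradient Ω ψ G := ⟨G, h⟩
  rw [weakGradient, dif_pos hex]
  exact hex.choose_spec.ae_eq hΩ h

end WeakGradient

/-- Every `H¹` function on the ball has a trace. -/
theorem exists_isTrace (hN : 3 ≤ N) (hψ : MemLp ψ 2 (volume.restrict (unitBall N)))
    (hG : MemLp G 2 (volume.restrict (unitBall N))) (h : HasWeakGradient (unitBall N) ψ G) :
    ∃ g, IsTrace ψ g := by
  obtain ⟨v, hv, h1, h2, -⟩ := exists_contDiff_approx one_pos h hψ hG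
  obtain ⟨g, hg, h3⟩ := exists_tendsto_boundary hN hv hψ hG h1 h2
  refine ⟨g, hg, v, hv, h1, h2.congr fun n => eLpNorm_congr_ae ?_, h3⟩
  filter_upwards [weakGradient_ae_eq Metric.isOpen_ball h] with x hx
  rw [hx]

/-- Since a trace exists, `trace` is not the default 0, and the identity is proved along the very
sequence that witnesses the chosen trace. Uniqueness of traces is thus not needed; only the chosen
weak gradient has to be compared with G. -/
theorem hardy_identity_trace (hN : 3 ≤ N) (hψ : MemLp ψ 2 (volume.restrict (unitBall N)))
    (hG : MemLp G 2 (volume.restrict (unitBall N))) (h : HasWeakGradient (unitBall N) ψ G) :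
    MemLp (hardyField ψ) 2 (volume.restrict (unitBall N)) ∧
    ((N : ℝ) - 2) * (∫ x in unitBall N, ‖hardyField ψ x‖ ^ 2)
      + 2 * ∫ x in unitBall N, inner ℝ (hardyField ψ x) (G x)
      = ∫ y, trace ψ y ^ 2 ∂(surfaceMeasure N) := by
  have hex := exists_isTrace hN hψ hG h
  have htr : IsTrace ψ (trace ψ) := by
    rw [trace, dif_pos hex]
    exact hex.choose_spec
  obtain ⟨hg, v, hv, h1, h2, h3⟩ := htr
  have h2' : Tendsto (fun n => eLpNorm (fun x => gradient (v n) x - G x) 2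
      (volume.restrict (unitBall N))) atTop (𝓝 0) := by
    refine h2.congr fun n => eLpNorm_congr_ae ?_
    filter_upwards [weakGradient_ae_eq Metric.isOpen_ball h] with x hx
    rw [hx]
  exact ⟨(tendsto_hardyField hN hv hψ hG h1 h2').1, hardy_identity hN hv hψ hG h1 h2' hg h3⟩

end

/-! ### Powers of the norm: integrability and weak gradient -/

section Power

variable {N : ℕ}

theorem norm_hardyField_rpow_sq (β : ℝ) {x : EuclideanSpace ℝ (Fin N)} (hx : x ≠ 0) :
    ‖hardyField (fun x => ‖x‖ ^ (-β)) x‖ ^ 2 = ‖x‖ ^ (-2 * β - 2) := by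
  have h0 := norm_pos_iff.2 hx
  rw [norm_hardyField_sq, hardyWeight, ← Real.rpow_natCast, ← Real.rpow_neg h0.le,
    ← Real.rpow_natCast, ← Real.rpow_mul h0.le, ← Real.rpow_add h0]
  congr 1
  push_cast; ring

theorem memLp_rpow [NeZero N] {β : ℝ} (hβ : β < (N : ℝ) / 2) :
    MemLp (fun x : EuclideanSpace ℝ (Fin N) => ‖x‖ ^ (-β)) 2 (volume.restrict (unitBall N)) := by
  have hm : Measurable fun x : EuclideanSpace ℝ (Fin N) => ‖x‖ ^ (-β) := by fun_prop
  rw [memLp_two_iff_integrable_sq hm.aestronglyMeasurable]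
  refine ((integrableOn_norm_rpow_iff (N := N) (-2 * β)).2 (by linarith)).congr ?_
  filter_upwards [ae_ne_zero_unitBall] with x hx
  rw [← Real.rpow_natCast, ← Real.rpow_mul (norm_nonneg _)]
  congr 1; push_cast; ring

/-- The squared length is |x|^(-2β-2), integrable exactly when 2β + 2 < N. This criterion separates
the two cases of the theorem. -/
theorem memLp_hardyField_rpow_iff [NeZero N] {β : ℝ} :
    MemLp (hardyField fun x : EuclideanSpace ℝ (Fin N) => ‖x‖ ^ (-β)) 2
      (volume.restrict (unitBall N)) ↔ β < ((N : ℝ) - 2) / 2 := by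
  have hm : AEStronglyMeasurable (hardyField fun x : EuclideanSpace ℝ (Fin N) => ‖x‖ ^ (-β))
      (volume.restrict (unitBall N)) :=
    aestronglyMeasurable_hardyField
      (by fun_prop : Measurable fun x : EuclideanSpace ℝ (Fin N) =>
        ‖x‖ ^ (-β)).aestronglyMeasurable
  rw [memLp_two_iff_integrable_sq_norm hm, integrable_congr (g := fun x => ‖x‖ ^ (-2 * β - 2))]
  · refine (integrableOn_norm_rpow_iff (N := N) (-2 * β - 2)).trans ?_
    constructor <;> intro h <;> linarith
  · filter_upwards [ae_ne_zero_unitBall] with x hx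
    exact norm_hardyField_rpow_sq β hx

/-- A majorant independent of ε, for dominated convergence: for s ≥ 0 the base is at most 2, and for
s < 0 dropping ε increases the power. The sum covers both signs. -/
theorem regularized_rpow_le {t ε : ℝ} (ht : 0 < t) (ht1 : t < 1) (hε : 0 < ε) (hε1 : ε ≤ 1)
    (s : ℝ) : (t ^ 2 + ε) ^ s ≤ t ^ (2 * s) + 2 ^ |s| := by
  rcases le_or_gt 0 s with hs | hs
  · have h1 : (t ^ 2 + ε) ^ s ≤ 2 ^ s := by
      refine Real.rpow_le_rpow (by positivity) ?_ hs
      nlinarith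
    rw [abs_of_nonneg hs]
    have : 0 ≤ t ^ (2 * s) := by positivity
    linarith
  · have h1 : (t ^ 2 + ε) ^ s ≤ (t ^ 2) ^ s :=
      Real.rpow_le_rpow_of_nonpos (by positivity) (by linarith) hs.le
    rw [← Real.rpow_natCast, ← Real.rpow_mul ht.le] at h1
    have : (0 : ℝ) ≤ 2 ^ |s| := by positivity
    push_cast at h1
    rw [← Real.rpow_natCast]
    push_cast
    linarith

theorem tendsto_regularized_rpow {t : ℝ} (ht : 0 < t) (s : ℝ) :
    Tendsto (fun n : ℕ => (t ^ 2 + 1 / ((n : ℝ) + 1)) ^ s) atTop (𝓝 (t ^ (2 * s))) := by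
  have h1 : Tendsto (fun n : ℕ => t ^ 2 + 1 / ((n : ℝ) + 1)) atTop (𝓝 (t ^ 2 + 0)) :=
    tendsto_const_nhds.add tendsto_one_div_add_atTop_nhds_zero_nat
  rw [add_zero] at h1
  have h2 := h1.rpow_const (p := s) (Or.inl (by positivity))
  have h3 : (t ^ 2) ^ s = t ^ (2 * s) := by
    rw [← Real.rpow_natCast, ← Real.rpow_mul ht.le]; norm_num
  rwa [h3] at h2

theorem hasFDerivAt_regularized {ε : ℝ} (hε : 0 < ε) (s : ℝ) (x : EuclideanSpace ℝ (Fin N)) :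
    HasFDerivAt (fun x : EuclideanSpace ℝ (Fin N) => (‖x‖ ^ 2 + ε) ^ s)
      ((2 * s * (‖x‖ ^ 2 + ε) ^ (s - 1)) • innerSL ℝ x) x := by
  have h1 : HasFDerivAt (fun x : EuclideanSpace ℝ (Fin N) => ‖x‖ ^ 2 + ε)
      (2 • innerSL ℝ x) x := ((hasStrictFDerivAt_norm_sq x).hasFDerivAt).add_const ε
  refine (h1.rpow_const (Or.inl (by positivity))).congr_fderiv ?_
  ext v
  simp
  ring

/-- Integration by parts for the regularized power. -/
theorem integral_regularized {ε : ℝ} (hε : 0 < ε) (s : ℝ) {φ : EuclideanSpace ℝ (Fin N) → ℝ}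
    (hφ : ContDiff ℝ ∞ φ) (hc : HasCompactSupport φ) (hs : tsupport φ ⊆ unitBall N)
    (v : EuclideanSpace ℝ (Fin N)) :
    ∫ x in unitBall N, (‖x‖ ^ 2 + ε) ^ s * fderiv ℝ φ x v
      = - ∫ x in unitBall N, 2 * s * ((‖x‖ ^ 2 + ε) ^ (s - 1) * inner ℝ x v) * φ x := by
  have hfd := hasFDerivAt_regularized (N := N) hε s
  have hc1 : ∀ s : ℝ, Continuous fun x : EuclideanSpace ℝ (Fin N) => (‖x‖ ^ 2 + ε) ^ s := fun s =>
    (by fun_prop : Continuous fun x : EuclideanSpace ℝ (Fin N) => ‖x‖ ^ 2 + ε).rpow_const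
      fun x => Or.inl (by positivity)
  have hd : ∀ x, fderiv ℝ (fun x : EuclideanSpace ℝ (Fin N) => (‖x‖ ^ 2 + ε) ^ s) x v
      = 2 * s * ((‖x‖ ^ 2 + ε) ^ (s - 1) * inner ℝ x v) := by
    intro x; rw [(hfd x).fderiv]; simp; ring
  have hφ' : Continuous fun x => fderiv ℝ φ x v :=
    (hφ.continuous_fderiv (by simp)).clm_apply continuous_const
  have hc' : HasCompactSupport fun x => fderiv ℝ φ x v := hc.fderiv_apply ℝ v
  have hcd : Continuous fun x : EuclideanSpace ℝ (Fin N) =>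
      2 * s * ((‖x‖ ^ 2 + ε) ^ (s - 1) * inner ℝ x v) :=
    continuous_const.mul ((hc1 _).mul (by fun_prop))
  have hibp := integral_mul_fderiv_eq_neg_fderiv_mul_of_integrable (μ := volume)
    (f := fun x : EuclideanSpace ℝ (Fin N) => (‖x‖ ^ 2 + ε) ^ s) (g := φ) (v := v)
    (by simp only [hd]; exact (hcd.mul hφ.continuous).integrable_of_hasCompactSupport hc.mul_left)
    (((hc1 s).mul hφ').integrable_of_hasCompactSupport hc'.mul_left)
    (((hc1 s).mul hφ.continuous).integrable_of_hasCompactSupport hc.mul_left)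
    (fun x _ => (hfd x).differentiableAt) (fun x _ => hφ.differentiable (by simp) x)
  simp only [hd] at hibp
  have hz : ∀ x ∉ unitBall N, φ x = 0 := fun x hx =>
    image_eq_zero_of_notMem_tsupport fun h => hx (hs h)
  have hz' : ∀ x ∉ unitBall N, fderiv ℝ φ x v = 0 := fun x hx => by
    rw [fderiv_of_notMem_tsupport ℝ fun h => hx (hs h)]; simp
  rw [setIntegral_eq_integral_of_forall_compl_eq_zero fun x hx => by rw [hz' x hx, mul_zero],
    setIntegral_eq_integral_of_forall_compl_eq_zero fun x hx => by rw [hz x hx, mul_zero], hibp]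

/-- The weak gradient of a power of the norm. -/
theorem hasWeakGradient_rpow (hN : 3 ≤ N) {β : ℝ} (hβ : β < ((N : ℝ) - 2) / 2) :
    HasWeakGradient (unitBall N) (fun x => ‖x‖ ^ (-β))
      (fun x => (-β) • hardyField (fun x => ‖x‖ ^ (-β)) x) := by
  have : NeZero N := ⟨by omega⟩
  have hN' : (3 : ℝ) ≤ N := by exact_mod_cast hN
  have hloc : ∀ {F : Type} [NormedAddCommGroup F] {w : EuclideanSpace ℝ (Fin N) → F},
      MemLp w 2 (volume.restrict (unitBall N)) → LocallyIntegrableOn w (unitBall N) := by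
    intro F _ w hw
    have : IntegrableOn w (unitBall N) := hw.integrable (by norm_num)
    exact this.locallyIntegrableOn
  refine ⟨hloc (memLp_rpow (by linarith)),
    hloc ((memLp_hardyField_rpow_iff.2 hβ).const_smul (-β)), fun φ hφ hc hs v => ?_⟩
  have hreg := fun n : ℕ => integral_regularized (N := N) (ε := 1 / ((n : ℝ) + 1)) (by positivity)
    (-β / 2) hφ hc hs v
  have hφ' : Continuous fun x => fderiv ℝ φ x v :=
    (hφ.continuous_fderiv (by simp)).clm_apply continuous_const
  obtain ⟨C₁, hC₁0, hC₁⟩ := exists_bound_unitBall hφ'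
  obtain ⟨C₂, hC₂0, hC₂⟩ := exists_bound_unitBall hφ.continuous
  have hε : ∀ n : ℕ, 0 < 1 / ((n : ℝ) + 1) := fun n => by positivity
  have hε1 : ∀ n : ℕ, 1 / ((n : ℝ) + 1) ≤ 1 := fun n => by
    rw [div_le_one (by positivity)]; linarith [n.cast_nonneg (α := ℝ)]
  have hball : ∀ᵐ x : EuclideanSpace ℝ (Fin N) ∂(volume.restrict (unitBall N)),
      0 < ‖x‖ ∧ ‖x‖ < 1 ∧ x ∈ Metric.closedBall (0 : EuclideanSpace ℝ (Fin N)) 1 := by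
    filter_upwards [ae_ne_zero_unitBall, ae_restrict_mem measurableSet_ball] with x hx0 hx
    exact ⟨norm_pos_iff.2 hx0, mem_ball_zero_iff.1 hx, Metric.ball_subset_closedBall hx⟩
  have hbound : ∀ s : ℝ, -(N : ℝ) < 2 * s → Integrable
      (fun x : EuclideanSpace ℝ (Fin N) => ‖x‖ ^ (2 * s) + 2 ^ |s|)
      (volume.restrict (unitBall N)) := fun s hs =>
    Integrable.add ((integrableOn_norm_rpow_iff _).2 hs) (integrable_const _)
  have hm : ∀ n : ℕ, ∀ s : ℝ, Measurable fun x : EuclideanSpace ℝ (Fin N) =>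
      (‖x‖ ^ 2 + 1 / ((n : ℝ) + 1)) ^ s := fun n s => by fun_prop
  have l1 : Tendsto (fun n : ℕ => ∫ x in unitBall N,
      (‖x‖ ^ 2 + 1 / ((n : ℝ) + 1)) ^ (-β / 2) * fderiv ℝ φ x v) atTop
      (𝓝 (∫ x in unitBall N, ‖x‖ ^ (-β) * fderiv ℝ φ x v)) := by
    refine tendsto_integral_of_dominated_convergence
      (fun x => (‖x‖ ^ (2 * (-β / 2)) + 2 ^ |-β / 2|) * C₁)
      (fun n => ((hm n _).mul hφ'.measurable).aestronglyMeasurable)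
      ((hbound _ (by linarith)).mul_const _) (fun n => ?_) ?_
    · filter_upwards [hball] with x hx
      rw [norm_mul, Real.norm_of_nonneg (Real.rpow_nonneg (by positivity) _)]
      gcongr
      · exact regularized_rpow_le hx.1 hx.2.1 (hε n) (hε1 n) _
      · exact hC₁ x hx.2.2
    · filter_upwards [hball] with x hx
      refine Tendsto.mul_const _ ?_
      have := tendsto_regularized_rpow hx.1 (-β / 2)
      rwa [mul_div_cancel₀ _ two_ne_zero] at this
  have l2 : Tendsto (fun n : ℕ => ∫ x in unitBall N,
      2 * (-β / 2) * ((‖x‖ ^ 2 + 1 / ((n : ℝ) + 1)) ^ (-β / 2 - 1) * inner ℝ x v) * φ x) atTop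
      (𝓝 (∫ x in unitBall N,
        inner ℝ ((-β) • hardyField (fun x => ‖x‖ ^ (-β)) x) v * φ x)) := by
    refine tendsto_integral_of_dominated_convergence
      (fun x => |2 * (-β / 2)| * (((‖x‖ ^ (2 * (-β / 2 - 1 / 2)) + 2 ^ |-β / 2 - 1 / 2|)) * ‖v‖)
        * C₂)
      (fun n => ((((hm n _).mul (by fun_prop)).const_mul _).mul
        hφ.continuous.measurable).aestronglyMeasurable)
      ((((hbound _ (by linarith)).mul_const _).const_mul _).mul_const _) (fun n => ?_) ?_
    · filter_upwards [hball] with x hx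
      have hq : 0 < ‖x‖ ^ 2 + 1 / ((n : ℝ) + 1) := add_pos_of_nonneg_of_pos (sq_nonneg _) (hε n)
      rw [norm_mul, norm_mul (2 * (-β / 2)), norm_mul (_ ^ (-β / 2 - 1)), Real.norm_eq_abs (2 * (-β / 2)),
        Real.norm_of_nonneg (Real.rpow_nonneg hq.le _)]
      refine mul_le_mul (mul_le_mul_of_nonneg_left ?_ (abs_nonneg _)) (hC₂ x hx.2.2)
        (norm_nonneg _) (by positivity)
      -- One factor |x| is at most (|x|² + ε)^(1/2), which raises the exponent to -β/2 - 1/2; the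
      -- singular part of the majorant is then |x|^(-β-1), integrable since β < N - 1.
      · calc _ ≤ (‖x‖ ^ 2 + 1 / ((n : ℝ) + 1)) ^ (-β / 2 - 1) * (‖x‖ * ‖v‖) := by
              gcongr; exact norm_inner_le_norm _ _
          _ ≤ (‖x‖ ^ 2 + 1 / ((n : ℝ) + 1)) ^ (-β / 2 - 1)
              * ((‖x‖ ^ 2 + 1 / ((n : ℝ) + 1)) ^ (1 / 2 : ℝ) * ‖v‖) := by
              gcongr
              rw [← Real.sqrt_eq_rpow]
              exact Real.le_sqrt_of_sq_le (by linarith [hε n])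
          _ = (‖x‖ ^ 2 + 1 / ((n : ℝ) + 1)) ^ (-β / 2 - 1 / 2) * ‖v‖ := by
              rw [← mul_assoc, ← Real.rpow_add hq]; congr 2; ring
          _ ≤ _ := by
              gcongr
              exact regularized_rpow_le hx.1 hx.2.1 (hε n) (hε1 n) _
    · filter_upwards [hball] with x hx
      refine Tendsto.mul_const _ ?_
      have h1 := ((tendsto_regularized_rpow hx.1 (-β / 2 - 1)).mul_const (inner ℝ x v)).const_mul
        (2 * (-β / 2))
      convert h1 using 2
      have h2 : (2 : ℝ) * (-β / 2 - 1) = -β - (2 : ℕ) := by push_cast; ring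
      rw [real_inner_smul_left, hardyField, real_inner_smul_left, h2, Real.rpow_sub hx.1,
        Real.rpow_natCast]
      ring
  exact tendsto_nhds_unique l1 (l2.neg.congr fun n => (hreg n).symm)

end Power

/-! ### The equation ∇ψ = -α ψ x/|x|² -/

section Rigidity

variable {N : ℕ}

/-- A function with vanishing weak gradient on a ball is a.e. constant there. -/
theorem ae_const_of_hasWeakGradient_zero {a : EuclideanSpace ℝ (Fin N)} {r : ℝ} (hr : 0 < r)
    {w : EuclideanSpace ℝ (Fin N) → ℝ} (hw : MemLp w 2 (volume.restrict (Metric.ball a r)))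
    (h : HasWeakGradient (Metric.ball a r) w 0) :
    ∃ c, ∀ᵐ x ∂(volume.restrict (Metric.ball a r)), w x = c := by
  obtain ⟨v, hv, h1, -, h3⟩ := exists_contDiff_approx hr h hw (MemLp.zero)
  have hconst : ∀ n, ∀ x ∈ Metric.ball a r, v n x = v n a := fun n x hx =>
    Metric.isOpen_ball.is_const_of_fderiv_eq_zero Metric.isPreconnected_ball
      ((hv n).differentiable one_ne_zero).differentiableOn
      (fun y hy => by
        ext z
        rw [← inner_gradient_eq (hv n), h3 rfl n y hy]
        simp) hx (Metric.mem_ball_self hr)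
  -- Each approximation is constant on the ball; a subsequence converges a.e., so w(x) is the limit
  -- of one numerical sequence for almost every x.
  obtain ⟨ns, -, hns⟩ := (tendstoInMeasure_of_tendsto_eLpNorm two_ne_zero
    (fun n => (hv n).continuous.aestronglyMeasurable) hw.1 h1).exists_seq_tendsto_ae
  have hlim : ∀ᵐ x ∂(volume.restrict (Metric.ball a r)),
      Tendsto (fun k => v (ns k) a) atTop (𝓝 (w x)) := by
    filter_upwards [hns, ae_restrict_mem measurableSet_ball] with x hx hxb
    exact hx.congr fun k => hconst _ x hxb
  have hne : NeBot (ae (volume.restrict (Metric.ball a r))) := by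
    rw [ae_neBot, Ne, Measure.restrict_eq_zero]
    exact (Metric.measure_ball_pos volume a hr).ne'
  obtain ⟨x₀, hx₀⟩ := hlim.exists
  exact ⟨w x₀, hlim.mono fun x hx => tendsto_nhds_unique hx hx₀⟩

/-- A function that is locally a.e. constant on a preconnected open set is a.e. constant. -/
theorem ae_const_of_locally {U : Set (EuclideanSpace ℝ (Fin N))} (hU : IsOpen U)
    (hc : IsPreconnected U) {w : EuclideanSpace ℝ (Fin N) → ℝ}
    (h : ∀ x ∈ U, ∃ r > 0, ∃ c, ∀ᵐ y ∂(volume.restrict (Metric.ball x r)), w y = c) :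
    ∃ c, ∀ᵐ x ∂(volume.restrict U), w x = c := by
  choose! r hr c hrc using h
  rcases U.eq_empty_or_nonempty with rfl | ⟨x₀, hx₀⟩
  · exact ⟨0, by simp⟩
  have hconst : ∀ x ∈ U, c x₀ = c x := by
    intro x hx
    -- The local constants agree at nearby points: the two balls meet in a nonempty open set, which
    -- has positive measure and so contains a point where both values hold.
    refine hc.induction₂ (fun x y => c x = c y) (fun x hx => ?_) (fun _ _ _ _ _ _ => Eq.trans)
      (fun _ _ _ _ => Eq.symm) hx₀ hx
    filter_upwards [self_mem_nhdsWithin,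
      mem_nhdsWithin_of_mem_nhds (Metric.ball_mem_nhds x (hr x hx))] with y hy hyx
    have hne : NeBot (ae (volume.restrict (Metric.ball x (r x) ∩ Metric.ball y (r y)))) := by
      rw [ae_neBot, Ne, Measure.restrict_eq_zero]
      exact ((Metric.isOpen_ball.inter Metric.isOpen_ball).measure_pos volume
        ⟨y, hyx, Metric.mem_ball_self (hr y hy)⟩).ne'
    have e1 := ae_restrict_of_ae_restrict_of_subset 
      (Set.inter_subset_left (t := Metric.ball y (r y))) (hrc x hx)
    have e2 := ae_restrict_of_ae_restrict_of_subset
      (Set.inter_subset_right (s := Metric.ball x (r x))) (hrc y hy)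
    obtain ⟨z, hz1, hz2⟩ := (e1.and e2).exists
    exact hz1.symm.trans hz2
  refine ⟨c x₀, ?_⟩
  rw [ae_restrict_iff' hU.measurableSet, ae_iff]
  refine measure_null_of_locally_null _ fun x hx => ?_
  have hxU : x ∈ U := by
    by_contra hxU
    exact hx fun h => absurd h hxU
  have hz := hrc x hxU
  rw [ae_restrict_iff' measurableSet_ball, ae_iff] at hz
  refine ⟨_, Filter.mem_of_superset (inter_mem_nhdsWithin _ (Metric.ball_mem_nhds x (hr x hxU)))
    ?_, hz⟩
  rintro y ⟨hy1, hy2⟩ hy3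
  exact hy1 fun _ => (hy3 hy2).trans (hconst x hxU).symm

/-- The set is the image of (0,1) × sphere under scaling, and the sphere is connected in dimension
greater than 1. -/
theorem isPreconnected_punctured_unitBall (hN : 3 ≤ N) :
    IsPreconnected (unitBall N \ {0}) := by
  have hrank : 1 < Module.rank ℝ (EuclideanSpace ℝ (Fin N)) :=
    Module.one_lt_rank_of_one_lt_finrank (by simp; omega)
  have hpre := (isPreconnected_Ioo (a := (0 : ℝ)) (b := 1)).prod
    (isPreconnected_sphere hrank (0 : EuclideanSpace ℝ (Fin N)) 1)
  have himg := hpre.image (fun p => p.1 • p.2) (by fun_prop)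
  rw [Set.image_smul_prod, Ioo_smul_sphere_zero le_rfl one_pos] at himg
  simpa using himg

theorem contDiff_rpow_mul (α : ℝ) {η : EuclideanSpace ℝ (Fin N) → ℝ} (hη : ContDiff ℝ ∞ η)
    (h0 : (0 : EuclideanSpace ℝ (Fin N)) ∉ tsupport η) :
    ContDiff ℝ ∞ fun x => ‖x‖ ^ α * η x := by
  rw [contDiff_iff_contDiffAt]
  intro x
  by_cases hx : x ∈ tsupport η
  · have hx0 : x ≠ 0 := fun h => h0 (h ▸ hx)
    exact ((contDiffAt_norm ℝ hx0).rpow_const_of_ne (norm_ne_zero_iff.2 hx0)).mul hη.contDiffAt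
  · refine (contDiffAt_const (c := (0 : ℝ))).congr_of_eventuallyEq ?_
    filter_upwards [notMem_tsupport_iff_eventuallyEq.1 hx] with y hy
    simp [hy]

theorem hasFDerivAt_norm_rpow_of_ne (α : ℝ) {x : EuclideanSpace ℝ (Fin N)} (hx : x ≠ 0) :
    HasFDerivAt (fun x : EuclideanSpace ℝ (Fin N) => ‖x‖ ^ α)
      ((α * ‖x‖ ^ α * (‖x‖ ^ 2)⁻¹) • innerSL ℝ x) x := by
  have h0 : 0 < ‖x‖ := norm_pos_iff.2 hx
  have h1 : HasFDerivAt (fun x : EuclideanSpace ℝ (Fin N) => ‖x‖ ^ 2)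
      (2 • innerSL ℝ x) x := (hasStrictFDerivAt_norm_sq x).hasFDerivAt
  have h2 := h1.rpow_const (p := α / 2) (Or.inl (by positivity))
  have h3 : ∀ y : EuclideanSpace ℝ (Fin N), (‖y‖ ^ 2) ^ (α / 2) = ‖y‖ ^ α := by
    intro y
    rw [← Real.rpow_natCast, ← Real.rpow_mul (norm_nonneg _)]
    congr 1; push_cast; ring
  simp only [h3] at h2
  refine h2.congr_fderiv ?_
  have h4 : (‖x‖ ^ 2) ^ (α / 2 - 1) = ‖x‖ ^ α * (‖x‖ ^ 2)⁻¹ := by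
    rw [Real.rpow_sub_one (by positivity), h3, div_eq_mul_inv]
  rw [h4]
  ext v
  simp
  ring

/-- If `∇ψ = -α ψ x / |x|²` then `|x|^α ψ` has vanishing weak gradient away from the origin. -/
theorem hasWeakGradient_zero_of_hardyField {α : ℝ} {ψ : EuclideanSpace ℝ (Fin N) → ℝ}
    (h : HasWeakGradient (unitBall N) ψ fun x => (-α) • hardyField ψ x)
    {a : EuclideanSpace ℝ (Fin N)} {r : ℝ} (hsub : Metric.ball a r ⊆ unitBall N \ {0})
    (hL : LocallyIntegrableOn (fun x => ‖x‖ ^ α * ψ x) (Metric.ball a r)) :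
    HasWeakGradient (Metric.ball a r) (fun x => ‖x‖ ^ α * ψ x) 0 := by
  refine ⟨hL, locallyIntegrable_zero.locallyIntegrableOn _, fun η hη hc hs v => ?_⟩
  have h0 : (0 : EuclideanSpace ℝ (Fin N)) ∉ tsupport η := fun h => (hsub (hs h)).2 rfl
  -- The weight is moved onto the test function, which stays smooth because the support of η avoids
  -- the origin.
  set φ : EuclideanSpace ℝ (Fin N) → ℝ := fun x => ‖x‖ ^ α * η x with hφdef
  have hφ : ContDiff ℝ ∞ φ := contDiff_rpow_mul α hη h0
  have hφs : tsupport φ ⊆ tsupport η := tsupport_mul_subset_right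
  have hφc : HasCompactSupport φ := hc.mul_left
  have hφB : tsupport φ ⊆ unitBall N := fun x hx => (hsub (hs (hφs hx))).1
  have hkey := h.2.2 φ hφ hφc hφB v
  have hφ' : Continuous fun x => fderiv ℝ φ x v :=
    (hφ.continuous_fderiv (by simp)).clm_apply continuous_const
  have i1 : Integrable (fun x => fderiv ℝ φ x v • ψ x) :=
    integrableOn_mul_of_test h.1 hφ' (hφc.fderiv_apply ℝ v)
      ((tsupport_fderiv_apply_subset ℝ v).trans hφB)
  have i2 : Integrable (fun x => inner ℝ ((-α) • hardyField ψ x) v * φ x) := by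
    have := Integrable.inner_const (𝕜 := ℝ)
      (integrableOn_mul_of_test h.2.1 hφ.continuous hφc hφB) v
    refine this.congr (.of_forall fun x => ?_)
    simp only [real_inner_smul_left]; ring
  -- By the Leibniz rule, the derivative of |x|^α produces exactly the term that cancels the radial
  -- gradient of ψ.
  have hpt : ∀ x, ψ x * fderiv ℝ φ x v + inner ℝ ((-α) • hardyField ψ x) v * φ x
      = ‖x‖ ^ α * ψ x * fderiv ℝ η x v := by
    intro x
    by_cases hx : x ∈ tsupport η
    · have hx0 : x ≠ 0 := fun h => h0 (h ▸ hx)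
      have hd := (hasFDerivAt_norm_rpow_of_ne α hx0).mul
        (hη.differentiable (by simp) x).hasFDerivAt
      rw [HasFDerivAt.fderiv (f := φ) hd]
      simp [hφdef, hardyField, real_inner_smul_left]
      ring
    · have e1 : fderiv ℝ η x = 0 := fderiv_of_notMem_tsupport ℝ hx
      have e2 : fderiv ℝ φ x = 0 := fderiv_of_notMem_tsupport ℝ fun h => hx (hφs h)
      have e3 : φ x = 0 := image_eq_zero_of_notMem_tsupport fun h => hx (hφs h)
      simp [e1, e2, e3]
  have hz : ∀ x ∉ Metric.ball a r, ‖x‖ ^ α * ψ x * fderiv ℝ η x v = 0 := fun x hx => by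
    rw [fderiv_of_notMem_tsupport ℝ fun h => hx (hs h)]; simp
  have hz' : ∀ x ∉ unitBall N, ‖x‖ ^ α * ψ x * fderiv ℝ η x v = 0 := fun x hx =>
    hz x fun h => hx (hsub h).1
  rw [setIntegral_eq_integral_of_forall_compl_eq_zero hz,
    ← setIntegral_eq_integral_of_forall_compl_eq_zero hz']
  simp only [← hpt]
  rw [integral_add (i1.restrict.congr (.of_forall fun x => by simp [mul_comm])) i2.restrict, hkey]
  simp

/-- The solutions of `∇ψ = -α ψ x / |x|²` in `H¹` are the multiples of `|x|^(-α)`. -/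
theorem ae_eq_const_mul_rpow (hN : 3 ≤ N) {α : ℝ} {ψ : EuclideanSpace ℝ (Fin N) → ℝ}
    (hψ : MemLp ψ 2 (volume.restrict (unitBall N)))
    (h : HasWeakGradient (unitBall N) ψ fun x => (-α) • hardyField ψ x) :
    ∃ c, ∀ᵐ x ∂(volume.restrict (unitBall N)), ψ x = c * ‖x‖ ^ (-α) := by
  have : NeZero N := ⟨by omega⟩
  have hopen : IsOpen (unitBall N \ {0}) := Metric.isOpen_ball.sdiff isClosed_singleton
  have hloc : ∀ x ∈ unitBall N \ {0}, ∃ r > 0, ∃ c,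
      ∀ᵐ y ∂(volume.restrict (Metric.ball x r)), ‖y‖ ^ α * ψ y = c := by
    intro x hx
    obtain ⟨r, hr, hrs⟩ := Metric.nhds_basis_closedBall.mem_iff.1 (hopen.mem_nhds hx)
    refine ⟨r, hr, ?_⟩
    have hsub : Metric.ball x r ⊆ unitBall N \ {0} := Metric.ball_subset_closedBall.trans hrs
    have hcont : ContinuousOn (fun y : EuclideanSpace ℝ (Fin N) => ‖y‖ ^ α)
        (Metric.closedBall x r) := fun y hy =>
      (continuous_norm.continuousAt.rpow_const
        (Or.inl (norm_ne_zero_iff.2 (hrs hy).2))).continuousWithinAt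
    obtain ⟨C, hC⟩ := (isCompact_closedBall x r).exists_bound_of_continuousOn hcont
    have hψr : MemLp ψ 2 (volume.restrict (Metric.ball x r)) :=
      hψ.mono_measure (Measure.restrict_mono (hsub.trans Set.sdiff_subset) le_rfl)
    have hm : Measurable fun y : EuclideanSpace ℝ (Fin N) => ‖y‖ ^ α := by fun_prop
    have hw : MemLp (fun y => ‖y‖ ^ α * ψ y) 2 (volume.restrict (Metric.ball x r)) := by
      refine hψr.of_le_mul (c := C) (hm.aestronglyMeasurable.mul hψr.1) ?_
      filter_upwards [ae_restrict_mem measurableSet_ball] with y hy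
      rw [norm_mul]
      gcongr
      exact hC y (Metric.ball_subset_closedBall hy)
    have : IsFiniteMeasure (volume.restrict (Metric.ball x r)) :=
      ⟨by rw [Measure.restrict_apply_univ]; exact measure_ball_lt_top⟩
    have hi : IntegrableOn (fun y => ‖y‖ ^ α * ψ y) (Metric.ball x r) :=
      hw.integrable (by norm_num)
    exact ae_const_of_hasWeakGradient_zero hr hw
      (hasWeakGradient_zero_of_hardyField h hsub hi.locallyIntegrableOn)
  obtain ⟨c, hc⟩ := ae_const_of_locally hopen (isPreconnected_punctured_unitBall hN) hloc
  refine ⟨c, ?_⟩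
  rw [ae_restrict_iff' hopen.measurableSet] at hc
  filter_upwards [ae_ne_zero_unitBall, ae_restrict_of_ae hc, ae_restrict_mem measurableSet_ball]
    with x hx0 hx hxB
  rw [← hx ⟨hxB, hx0⟩, Real.rpow_neg (norm_nonneg _)]
  have : ‖x‖ ^ α ≠ 0 := (Real.rpow_pos_of_pos (norm_pos_iff.2 hx0) _).ne'
  field_simp

end Rigidity

/-! ### The Robin form, its lower bound and the eigenvalue -/

section

variable {N : ℕ} {ψ : EuclideanSpace ℝ (Fin N) → ℝ}
  {G : EuclideanSpace ℝ (Fin N) → EuclideanSpace ℝ (Fin N)}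

theorem HasWeakGradient.congr_ae {Ω : Set (EuclideanSpace ℝ (Fin N))}
    {G' : EuclideanSpace ℝ (Fin N) → EuclideanSpace ℝ (Fin N)}
    (h : HasWeakGradient Ω ψ G) (hG : G =ᵐ[volume.restrict Ω] G') : HasWeakGradient Ω ψ G' := by
  refine ⟨h.1, h.2.1.congr hG, fun φ hφ hc hs v => ?_⟩
  rw [h.2.2 φ hφ hc hs v]
  congr 1
  refine integral_congr_ae ?_
  filter_upwards [hG] with x hx
  rw [hx]

theorem integral_hardyWeight (ψ : EuclideanSpace ℝ (Fin N) → ℝ) :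
    ∫ x in unitBall N, hardyWeight N x * ψ x ^ 2 = ∫ x in unitBall N, ‖hardyField ψ x‖ ^ 2 := by
  simp only [norm_hardyField_sq]

theorem integral_weakGradient_sq (h : HasWeakGradient (unitBall N) ψ G) :
    ∫ x in unitBall N, ‖weakGradient (unitBall N) ψ x‖ ^ 2 = ∫ x in unitBall N, ‖G x‖ ^ 2 := by
  refine integral_congr_ae ?_
  filter_upwards [weakGradient_ae_eq Metric.isOpen_ball h] with x hx
  rw [hx]

/-- Completing the square in the Robin form with boundary parameter `α`. -/
theorem robin_form_eq (hN : 3 ≤ N) (hψ : MemLp ψ 2 (volume.restrict (unitBall N)))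
    (hG : MemLp G 2 (volume.restrict (unitBall N))) (h : HasWeakGradient (unitBall N) ψ G) (α : ℝ) :
    (∫ x in unitBall N, ‖G x‖ ^ 2) + α * ∫ y, trace ψ y ^ 2 ∂(surfaceMeasure N)
      = (∫ x in unitBall N, ‖G x + α • hardyField ψ x‖ ^ 2)
        + α * ((N : ℝ) - 2 - α) * ∫ x in unitBall N, ‖hardyField ψ x‖ ^ 2 := by
  obtain ⟨hF, hid⟩ := hardy_identity_trace hN hψ hG h
  have hexp : ∀ x, ‖G x + α • hardyField ψ x‖ ^ 2
      = ‖G x‖ ^ 2 + (2 * α) * inner ℝ (hardyField ψ x) (G x) + α ^ 2 * ‖hardyField ψ x‖ ^ 2 := by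
    intro x
    rw [norm_add_sq_real, real_inner_smul_right, norm_smul, mul_pow, Real.norm_eq_abs, sq_abs,
      real_inner_comm]
    ring
  have i1 := integrable_norm_sq hG
  have i2 := (integrable_inner hF hG).const_mul (2 * α)
  have i3 := (integrable_norm_sq hF).const_mul (α ^ 2)
  have i12 : Integrable (fun x => ‖G x‖ ^ 2 + (2 * α) * inner ℝ (hardyField ψ x) (G x))
      (volume.restrict (unitBall N)) := i1.add i2
  simp only [hexp]
  rw [integral_add i12 i3, integral_add i1 i2, integral_const_mul, integral_const_mul,
    ← hid]
  ring

/-- Square integrability is essential: the integral of a non-integrable function is 0 by convention.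
Positivity allows the denominator of the quotient to be cleared. -/
theorem integral_hardyField_pos (hN : 3 ≤ N)
    (hF : MemLp (hardyField ψ) 2 (volume.restrict (unitBall N)))
    (h0 : ¬ ψ =ᵐ[volume.restrict (unitBall N)] 0) :
    0 < ∫ x in unitBall N, ‖hardyField ψ x‖ ^ 2 := by
  have : NeZero N := ⟨by omega⟩
  refine lt_of_le_of_ne (by positivity) fun h => h0 ?_
  have hz := (integral_eq_zero_iff_of_nonneg (fun x => by positivity)
    (integrable_norm_sq hF)).1 h.symm
  filter_upwards [hz, ae_ne_zero_unitBall] with x hx hx0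
  have h1 : |ψ x| * ‖x‖⁻¹ = 0 := by
    rw [← norm_hardyField]; simpa using hx
  rcases mul_eq_zero.1 h1 with h2 | h2
  · simpa using h2
  · exact absurd (norm_eq_zero.1 (inv_eq_zero.1 h2)) hx0

/-- The lower bound for the Robin quotient. -/
theorem le_robinQuotient (hN : 3 ≤ N) {α γ : ℝ} (hαγ : α ≤ γ) (hψ : IsAdmissible ψ) :
    α * ((N : ℝ) - 2 - α) ≤ robinQuotient (hardyWeight N) γ ψ := by
  obtain ⟨⟨hL, G, hG, h⟩, h0⟩ := hψ
  obtain ⟨hF, -⟩ := hardy_identity_trace hN hL hG h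
  have hform := robin_form_eq hN hL hG h α
  have hT : 0 ≤ ∫ y, trace ψ y ^ 2 ∂(surfaceMeasure N) := by positivity
  have hR : 0 ≤ ∫ x in unitBall N, ‖G x + α • hardyField ψ x‖ ^ 2 := by positivity
  rw [robinQuotient, integral_hardyWeight, integral_weakGradient_sq h,
    le_div_iff₀ (integral_hardyField_pos hN hF h0)]
  have := mul_nonneg (sub_nonneg.2 hαγ) hT
  linarith

/-- Functions for which the lower bound is an equality. -/
theorem eq_const_mul_rpow_of_robinQuotient_eq (hN : 3 ≤ N) {α γ : ℝ} (hαγ : α ≤ γ)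
    (hψ : IsAdmissible ψ) (heq : robinQuotient (hardyWeight N) γ ψ = α * ((N : ℝ) - 2 - α)) :
    MemLp (hardyField ψ) 2 (volume.restrict (unitBall N)) ∧ ∃ c : ℝ, c ≠ 0 ∧
      ∀ᵐ x ∂(volume.restrict (unitBall N)), ψ x = c * ‖x‖ ^ (-α) := by
  obtain ⟨⟨hL, G, hG, h⟩, h0⟩ := hψ
  obtain ⟨hF, -⟩ := hardy_identity_trace hN hL hG h
  have hform := robin_form_eq hN hL hG h α
  have hT : 0 ≤ ∫ y, trace ψ y ^ 2 ∂(surfaceMeasure N) := by positivity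
  have hR : 0 ≤ ∫ x in unitBall N, ‖G x + α • hardyField ψ x‖ ^ 2 := by positivity
  rw [robinQuotient, integral_hardyWeight, integral_weakGradient_sq h,
    div_eq_iff (integral_hardyField_pos hN hF h0).ne'] at heq
  have := mul_nonneg (sub_nonneg.2 hαγ) hT
  -- Equality makes the square and the boundary surplus, both nonnegative, sum to zero.
  have hR0 : ∫ x in unitBall N, ‖G x + α • hardyField ψ x‖ ^ 2 = 0 := by linarith
  have hz := (integral_eq_zero_iff_of_nonneg (fun x => by positivity)
    (integrable_norm_sq (hG.add (hF.const_smul α)))).1 hR0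
  have hGF : G =ᵐ[volume.restrict (unitBall N)] fun x => (-α) • hardyField ψ x := by
    filter_upwards [hz] with x hx
    have h1 : G x + α • hardyField ψ x = 0 := by simpa using hx
    rw [neg_smul]
    exact eq_neg_of_add_eq_zero_left h1
  obtain ⟨c, hc⟩ := ae_eq_const_mul_rpow hN hL (h.congr_ae hGF)
  refine ⟨hF, c, ?_, hc⟩
  rintro rfl
  exact h0 (by filter_upwards [hc] with x hx; simpa using hx)

/-- The Robin quotient of a power of the norm. -/
theorem robinQuotient_rpow (hN : 3 ≤ N) {β : ℝ} (hβ : β < ((N : ℝ) - 2) / 2) (γ : ℝ) :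
    IsAdmissible (fun x : EuclideanSpace ℝ (Fin N) => ‖x‖ ^ (-β)) ∧
      robinQuotient (hardyWeight N) γ (fun x : EuclideanSpace ℝ (Fin N) => ‖x‖ ^ (-β))
        = β ^ 2 + γ * ((N : ℝ) - 2 - 2 * β) := by
  have : NeZero N := ⟨by omega⟩
  set u : EuclideanSpace ℝ (Fin N) → ℝ := fun x => ‖x‖ ^ (-β) with hu
  have hL : MemLp u 2 (volume.restrict (unitBall N)) := memLp_rpow (by linarith)
  have hF : MemLp (hardyField u) 2 (volume.restrict (unitBall N)) :=
    memLp_hardyField_rpow_iff.2 hβ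
  have hG := hF.const_smul (-β)
  have h : HasWeakGradient (unitBall N) u fun x => (-β) • hardyField u x :=
    hasWeakGradient_rpow hN hβ
  have h0 : ¬ u =ᵐ[volume.restrict (unitBall N)] 0 := by
    intro hz
    have hne : NeBot (ae (volume.restrict (unitBall N))) := by
      rw [ae_neBot, Ne, Measure.restrict_eq_zero]
      exact (Metric.measure_ball_pos volume _ one_pos).ne'
    obtain ⟨x, hx, hx0⟩ := (hz.and ae_ne_zero_unitBall).exists
    exact (Real.rpow_pos_of_pos (norm_pos_iff.2 hx0) _).ne' hx
  refine ⟨⟨⟨hL, _, hG, h⟩, h0⟩, ?_⟩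
  have hid := (hardy_identity_trace hN hL hG h).2
  have e1 : ∀ x, inner ℝ (hardyField u x) (((-β) • hardyField u) x)
      = -β * ‖hardyField u x‖ ^ 2 := fun x => by
    rw [Pi.smul_apply, real_inner_smul_right, real_inner_self_eq_norm_sq]
  have e2 : ∀ x, ‖(-β) • hardyField u x‖ ^ 2 = β ^ 2 * ‖hardyField u x‖ ^ 2 := fun x => by
    rw [norm_smul, mul_pow, Real.norm_eq_abs, sq_abs, neg_sq]
  -- Here ∇u = -βF, so the Hardy identity evaluates the boundary integral as (N-2-2β) ∫|F|², with no
  -- need to compute the trace of u.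
  simp only [e1, integral_const_mul] at hid
  rw [robinQuotient, integral_hardyWeight, integral_weakGradient_sq h,
    div_eq_iff (integral_hardyField_pos hN hF h0).ne', ← hid]
  simp only [e2, integral_const_mul]
  ring

/-- Below the Hardy threshold. -/
theorem robinEigenvalue_of_lt (hN : 3 ≤ N) {γ : ℝ} (hγ : γ < ((N : ℝ) - 2) / 2) :
    robinEigenvalue (hardyWeight N) γ = ((γ * ((N : ℝ) - 2 - γ) : ℝ) : EReal) := by
  obtain ⟨hadm, hq⟩ := robinQuotient_rpow hN hγ γ
  refine le_antisymm ((iInf₂_le _ hadm).trans ?_) (le_iInf₂ fun ψ hψ => ?_)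
  · rw [hq, EReal.coe_le_coe_iff]
    exact le_of_eq (by ring)
  · exact EReal.coe_le_coe_iff.2 (le_robinQuotient hN le_rfl hψ)

/-- Above the Hardy threshold. -/
theorem robinEigenvalue_of_ge (hN : 3 ≤ N) {γ : ℝ} (hγ : ((N : ℝ) - 2) / 2 ≤ γ) :
    robinEigenvalue (hardyWeight N) γ = (((((N : ℝ) - 2) / 2) ^ 2 : ℝ) : EReal) := by
  refine le_antisymm ?_ (le_iInf₂ fun ψ hψ => ?_)
  · set α := ((N : ℝ) - 2) / 2 with hα
    -- The competitors are |x|^(-β) with β = α - 1/(n+1). The boundary contribution γ(N-2-2β)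
    -- vanishes as β tends to α = (N-2)/2, for every γ.
    have hlim : Tendsto (fun n : ℕ => (α - 1 / ((n : ℝ) + 1)) ^ 2
        + γ * ((N : ℝ) - 2 - 2 * (α - 1 / ((n : ℝ) + 1)))) atTop (𝓝 (α ^ 2)) := by
      have h1 : Tendsto (fun n : ℕ => α - 1 / ((n : ℝ) + 1)) atTop (𝓝 (α - 0)) :=
        tendsto_const_nhds.sub tendsto_one_div_add_atTop_nhds_zero_nat
      have h2 := (h1.pow 2).add (((h1.const_mul 2).const_sub ((N : ℝ) - 2)).const_mul γ)
      convert h2 using 2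
      rw [hα]; ring
    have hlim' := (continuous_coe_real_ereal.tendsto (α ^ 2)).comp hlim
    refine ge_of_tendsto' hlim' fun n => ?_
    have hn : α - 1 / ((n : ℝ) + 1) < ((N : ℝ) - 2) / 2 := by
      have : 0 < 1 / ((n : ℝ) + 1) := by positivity
      linarith
    obtain ⟨hadm, hq⟩ := robinQuotient_rpow hN hn γ
    refine (iInf₂_le _ hadm).trans ?_
    rw [hq]
    rfl
  · refine EReal.coe_le_coe_iff.2 (le_trans (le_of_eq ?_) (le_robinQuotient hN hγ hψ))
    ring

end

end RobinHardy

end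

theorem mainTheorem6 (N : ℕ) (hN : 3 ≤ N) (γ : ℝ) :
    (γ < ((N : ℝ) - 2) / 2 →
      RobinHardy.robinEigenvalue (RobinHardy.hardyWeight N) γ
          = ((γ * ((N : ℝ) - 2 - γ) : ℝ) : EReal) ∧
      RobinHardy.IsMinimizer (RobinHardy.hardyWeight N) γ (fun x => ‖x‖ ^ (-γ)) ∧
      ∀ ψ : EuclideanSpace ℝ (Fin N) → ℝ,
        RobinHardy.IsMinimizer (RobinHardy.hardyWeight N) γ ψ →
          ∃ c : ℝ, c ≠ 0 ∧
            ∀ᵐ x ∂(MeasureTheory.volume.restrict (RobinHardy.unitBall N)),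
              ψ x = c * ‖x‖ ^ (-γ)) ∧
    (((N : ℝ) - 2) / 2 ≤ γ →
      RobinHardy.robinEigenvalue (RobinHardy.hardyWeight N) γ
          = (((((N : ℝ) - 2) / 2) ^ 2 : ℝ) : EReal) ∧
      ¬ ∃ ψ : EuclideanSpace ℝ (Fin N) → ℝ,
        RobinHardy.IsMinimizer (RobinHardy.hardyWeight N) γ ψ) := by
  refine ⟨fun hγ => ?_, fun hγ => ?_⟩
  · have hval := RobinHardy.robinEigenvalue_of_lt hN hγ
    obtain ⟨hadm, hq⟩ := RobinHardy.robinQuotient_rpow hN hγ γ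
    refine ⟨hval, ⟨hadm, ?_⟩, fun ψ hψ => ?_⟩
    · rw [hval, hq, EReal.coe_eq_coe_iff]
      ring
    · have heq := hψ.2
      rw [hval, EReal.coe_eq_coe_iff] at heq
      exact (RobinHardy.eq_const_mul_rpow_of_robinQuotient_eq hN le_rfl hψ.1 heq).2
  · have hval := RobinHardy.robinEigenvalue_of_ge hN hγ
    refine ⟨hval, ?_⟩
    rintro ⟨ψ, hψ⟩
    have heq := hψ.2
    rw [hval, EReal.coe_eq_coe_iff] at heq
    -- With α = (N-2)/2 a minimizer would be a nonzero multiple of |x|^(-α) with square-integrable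
    -- Hardy field. Dividing by c and applying the integrability criterion gives α < α.
    obtain ⟨hF, c, hc, hae⟩ := RobinHardy.eq_const_mul_rpow_of_robinQuotient_eq hN hγ hψ.1
      (heq.trans (by ring))
    have : NeZero N := ⟨by omega⟩
    refine lt_irrefl _ (RobinHardy.memLp_hardyField_rpow_iff.1
      ((MemLp.ae_eq ?_ (hF.const_smul c⁻¹)) : MemLp _ 2 _))
    filter_upwards [hae] with x hx
    simp only [Pi.smul_apply, RobinHardy.hardyField, hx, smul_smul]
    congr 1
    field_simp
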